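/- **Comparison lemma.** Call a real number $A>0$ a *Remez constant* if for every $d\in\{0,1,2,\dots\}$, every real polynomial $p$ in one variable of degree at most $d$, every compact interval $J\subset\mathbb R$ of positive length $|J|$ and every measurable $E\subset J$ with Lebesgue measure $|E|>0$, $$\max_J |p|\le \Bigl[\frac{A|J|}{|E|}\Bigr]^d\sup_E|p| .$$ Then $A=4$ is a Remez constant, and every Remez constant $A$ has the following property. Let $n,d\ge 0$ be integers, let $P$ be a polynomial of degree at most $d$ in $n$ variables with real or complex coefficients, and let $F\subset\mathbb R^n$ be a convex compact set of volume $1$. Then for all real $c>0$ and $\lambda\ge1$, $$\operatorname{Vol}\{x\in F:\ |P(x)|\ge (A\lambda)^d c\}\le\bigl(\operatorname{Vol}\{x\in F:\ |P(x)|\ge c\}\bigr)^{\lambda}.$$ In particular the bound holds with $A=4$, independently of the dimension $n$. -/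

import Mathlib

open MeasureTheory

/-- `A` is an admissible constant in the one-dimensional Remez inequality
`max_J |P| ≤ (A |J| / |E|) ^ d * sup_E |P|`, for all real polynomials `P` of degree at most `d`,
all compact intervals `J = [a, b]` of positive length and all measurable `E ⊆ J` of positive
measure. The constant does not depend on `d`, `P`, `J` or `E`. -/
def IsRemezConstant (A : ℝ) : Prop :=
  0 < A ∧
    ∀ (d : ℕ) (P : Polynomial ℝ), P.natDegree ≤ d →
      ∀ a b : ℝ, a < b → ∀ E : Set ℝ, MeasurableSet E → E ⊆ Set.Icc a b → 0 < volume E →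
        ∀ x ∈ Set.Icc a b,
          |P.eval x| ≤
            (A * (b - a) / volume.real E) ^ d * sSup ((fun y : ℝ => |P.eval y|) '' E)

/-!
The constant `4` in the Remez inequality comes from Lagrange interpolation: the Chebyshev extremal
points of an interval of length `|E|` are lifted to points of `E` that are at least as far apart,
and the resulting sum is the leading coefficient of the Chebyshev polynomial
(`abs_eval_le_of_isCompact`, `isRemezConstant_four`).

For the comparison inequality, put `t = 1 / λ`. On a segment that starts at a point `x` with
`|P x| ≥ (A λ) ^ d c`, the Remez inequality says that the sublevel set `{|P| ≤ c}` occupies at most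
the fraction `t` of the length (`volume_sublevel_inter_uIcc_le`). What remains is geometric: such a
sparsity condition on all segments starting in `G` bounds the volume of `G`. There are two steps.

*One dimension* (`IsLogConcaveDensity.measureReal_le_of_sparse`). Let `ν` be a measure on the line
with log-concave density and total mass `M`, and let `H` be a closed set that occupies at most the
fraction `t` of every segment starting in `G`. Then `ν H ≤ ψ (M - ν G)`, where
`ψ u = M - M ^ (1 - t) * (M - u) ^ t`. If `H` is only known to be sparse as seen from one point `β`
on its right, a layer-cake argument shows that it cannot do better than a combination of a set of
density `t` on `(-∞, p]` and a whole interval `[p, q]` with `q = (1 - t) p + t β`, and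
log-concavity of the tails of `ν` bounds such combinations
(`IsLogConcaveDensity.measureReal_inter_Iic_le`). A component of the complement of `G` with both
ends in `G` is reduced to this by cutting the line at a suitable point
(`IsLogConcaveDensity.measureReal_inter_Icc_le`), and the components are added up because `ψ` is
superadditive.

*Reduction to one dimension.* If the inequality fails for a convex body, an intermediate value
argument cuts the body through any given flat of codimension two into two halves, both with the
same proportion of the superlevel set of `c`; on one of them the inequality still fails
(`IsBisectionBody.exists_half`). After cutting through all flats `x i = p`, `x j = q` with rational
`p`, `q`, the intersection of the bodies contains no nondegenerate triangle, so it lies on a line,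
and already after finitely many cuts the polynomial is almost constant across that line
(`IsBisectionBody.exists_thin`). The marginal of that thin body along the line is log-concave by the
Prékopa–Leindler inequality (`prekopa_leindler`, `isLogConcaveDensity_marginal`), and the
one-dimensional inequality gives a contradiction.
-/

open scoped ENNReal Pointwise Topology

/-! ### The Remez inequality with constant `4` -/

/-- The leading coefficient of the Chebyshev polynomial, computed by Lagrange interpolation at its
extremal points. All terms of the interpolation formula have the same sign. -/
theorem sum_inv_prod_abs_node_sub_node {d : ℕ} :
    ∑ i ∈ Finset.range (d + 1), (∏ j ∈ (Finset.range (d + 1)).erase i,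
      |Polynomial.Chebyshev.node d i - Polynomial.Chebyshev.node d j|)⁻¹ = 2 ^ (d - 1) := by
  have hinj := (Polynomial.Chebyshev.strictAntiOn_node d).injOn
  have hdeg : (Polynomial.Chebyshev.T ℝ d).degree < (Finset.range (d + 1)).card := by
    rw [Polynomial.Chebyshev.degree_T, Int.natAbs_natCast, Finset.card_range]
    exact_mod_cast Nat.lt_succ_self d
  have h := Lagrange.coeff_eq_sum hinj hdeg
  have hlead : (Polynomial.Chebyshev.T ℝ d).coeff ((Finset.range (d + 1)).card - 1)
      = 2 ^ (d - 1) := by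
    trans (Polynomial.Chebyshev.T ℝ d).leadingCoeff
    · simp [Polynomial.leadingCoeff]
    · simp
  rw [hlead] at h
  rw [h]
  refine Finset.sum_congr rfl fun i hi => ?_
  have hi' : i ≤ d := Nat.lt_succ_iff.mp (Finset.mem_range.mp hi)
  have hpos := Polynomial.Chebyshev.zero_lt_prod_node_sub_node hi'
  rw [Polynomial.Chebyshev.eval_T_real_node (Finset.mem_Iic.mpr hi'), ← Finset.abs_prod]
  rcases neg_one_pow_eq_or ℝ i with h1 | h1 <;> rw [h1] at hpos ⊢
  · rw [abs_of_pos (by linarith), one_div]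
  · rw [abs_of_neg (by linarith), inv_neg, neg_div, one_div]

/-- The mass of a set to the left of a point is a `1`-Lipschitz function of the point. -/
theorem abs_measureReal_inter_Iic_sub_le {S : Set ℝ} (hS : volume S ≠ ⊤) (x y : ℝ) :
    |volume.real (S ∩ Set.Iic x) - volume.real (S ∩ Set.Iic y)| ≤ |x - y| := by
  have key : ∀ x y : ℝ, x ≤ y →
      |volume.real (S ∩ Set.Iic x) - volume.real (S ∩ Set.Iic y)| ≤ |x - y| := by
    intro x y hxy
    have hfin : ∀ A : Set ℝ, volume (S ∩ A) ≠ ⊤ := fun A =>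
      measure_ne_top_of_subset Set.inter_subset_left hS
    have h1 : volume.real (S ∩ Set.Iic x) ≤ volume.real (S ∩ Set.Iic y) :=
      measureReal_mono (by gcongr) (hfin _)
    have h2 : volume.real (S ∩ Set.Iic y) ≤ volume.real (S ∩ Set.Iic x) + (y - x) := by
      calc volume.real (S ∩ Set.Iic y)
          ≤ volume.real ((S ∩ Set.Iic x) ∪ Set.Icc x y) := by
            refine measureReal_mono ?_ ?_
            · rintro z ⟨hz, hzy⟩
              rcases le_total z x with h | h
              · exact Or.inl ⟨hz, h⟩
              · exact Or.inr ⟨h, hzy⟩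
            · exact (measure_union_lt_top (hfin _).lt_top (by simp)).ne
        _ ≤ _ := by
            refine (measureReal_union_le _ _).trans ?_
            simp [hxy]
    rw [abs_sub_comm, abs_sub_comm x y, abs_of_nonneg (by linarith), abs_of_nonneg (by linarith)]
    linarith
  rcases le_total x y with h | h
  · exact key x y h
  · rw [abs_sub_comm, abs_sub_comm x y]
    exact key y x h

theorem continuous_measureReal_inter_Iic {S : Set ℝ} (hS : volume S ≠ ⊤) :
    Continuous fun x : ℝ => volume.real (S ∩ Set.Iic x) := by
  refine LipschitzWith.continuous (K := 1) (LipschitzWith.of_dist_le_mul fun x y => ?_)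
  simpa [Real.dist_eq] using abs_measureReal_inter_Iic_sub_le hS x y

/-- The lifting of points: some `y ∈ K` has exactly the mass `t` of `K` to its left. -/
theorem IsCompact.exists_mem_measureReal_inter_Iic_eq {K : Set ℝ} (hK : IsCompact K) {t : ℝ}
    (hne : K.Nonempty) (ht0 : 0 ≤ t) (ht : t ≤ volume.real K) :
    ∃ y ∈ K, volume.real (K ∩ Set.Iic y) = t := by
  set m : ℝ → ℝ := fun x => volume.real (K ∩ Set.Iic x) with hm
  have hmc : Continuous m := continuous_measureReal_inter_Iic hK.measure_lt_top.ne
  have hmono : Monotone m := fun x y hxy =>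
    measureReal_mono (by gcongr) (measure_ne_top_of_subset Set.inter_subset_left
      hK.measure_lt_top.ne)
  have hS : IsCompact (K ∩ {y | m y ≤ t}) :=
    hK.inter_right (isClosed_le hmc continuous_const)
  obtain ⟨a, haK, ha⟩ := hK.exists_isLeast hne
  obtain ⟨b, hbK, hb⟩ := hK.exists_isGreatest hne
  have hma : m a = 0 := by
    have : K ∩ Set.Iic a ⊆ {a} := fun z hz => le_antisymm hz.2 (ha hz.1)
    have h0 : volume (K ∩ Set.Iic a) = 0 := measure_mono_null this (by simp)
    simp [hm, measureReal_def, h0]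
  have hmb : m b = volume.real K := by
    simp only [hm]
    rw [Set.inter_eq_left.mpr (show K ⊆ Set.Iic b from fun z hz => hb hz)]
  obtain ⟨y, ⟨hyK, hyt⟩, hy⟩ := hS.exists_isGreatest ⟨a, haK, by simpa [hma] using ht0⟩
  refine ⟨y, hyK, le_antisymm hyt ?_⟩
  by_contra! hlt
  obtain ⟨z, hz, hzt⟩ := intermediate_value_Icc (hb hyK) hmc.continuousOn
    (show t ∈ Set.Icc (m y) (m b) from ⟨hyt, by rw [hmb]; exact ht⟩)
  have hsub : K ∩ Set.Iic z ⊆ K ∩ Set.Iic y := fun w hw =>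
    ⟨hw.1, hy ⟨hw.1, (hmono hw.2).trans hzt.le⟩⟩
  have : m z ≤ m y := measureReal_mono hsub (measure_ne_top_of_subset Set.inter_subset_left
      hK.measure_lt_top.ne)
  change m y < t at hlt
  linarith

/-- Remez inequality on a compact set. The Chebyshev points of an interval of length `|K|` are
lifted to points of `K` at least as far apart from each other, and Lagrange interpolation at the
lifted points is estimated term by term. -/
theorem abs_eval_le_of_isCompact {d : ℕ} (hd : d ≠ 0) {P : Polynomial ℝ} (hP : P.natDegree ≤ d)
    {a b : ℝ} {K : Set ℝ} (hK : IsCompact K) (hKab : K ⊆ Set.Icc a b)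
    (hpos : 0 < volume.real K) {M : ℝ} (hM : ∀ y ∈ K, |P.eval y| ≤ M) {x : ℝ}
    (hx : x ∈ Set.Icc a b) :
    |P.eval x| ≤ (4 * (b - a) / volume.real K) ^ d / 2 * M := by
  set s := volume.real K with hs
  have hne : K.Nonempty := by
    rw [Set.nonempty_iff_ne_empty]
    rintro rfl
    simp [hs] at hpos
  set τ : ℕ → ℝ := fun i => s * (1 - Polynomial.Chebyshev.node d i) / 2 with hτ
  have hnode : ∀ i, Polynomial.Chebyshev.node d i ∈ Set.Icc (-1 : ℝ) 1 :=
    fun i => Polynomial.Chebyshev.node_mem_Icc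
  have hlift : ∀ i, ∃ y ∈ K, volume.real (K ∩ Set.Iic y) = τ i := fun i => by
    obtain ⟨h1, h2⟩ := hnode i
    refine hK.exists_mem_measureReal_inter_Iic_eq hne ?_ ?_
    · simp only [hτ]; nlinarith
    · simp only [hτ]; nlinarith
  choose y hyK hyτ using hlift
  have hsep : ∀ i j, s / 2 * |Polynomial.Chebyshev.node d i - Polynomial.Chebyshev.node d j|
      ≤ |y i - y j| := fun i j => by
    have h := abs_measureReal_inter_Iic_sub_le hK.measure_lt_top.ne (y i) (y j)
    rw [hyτ, hyτ] at h
    refine le_trans (le_of_eq ?_) h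
    rw [show τ i - τ j = (s / 2) * -(Polynomial.Chebyshev.node d i
      - Polynomial.Chebyshev.node d j) by simp only [hτ]; ring, abs_mul, abs_neg,
      abs_of_pos (half_pos hpos)]
  have hnodepos : ∀ i ∈ Finset.range (d + 1), ∀ j ∈ (Finset.range (d + 1)).erase i,
      0 < |Polynomial.Chebyshev.node d i - Polynomial.Chebyshev.node d j| := by
    intro i hi j hj
    refine abs_pos.mpr (sub_ne_zero.mpr fun h => ?_)
    exact (Finset.mem_erase.mp hj).1
      ((Polynomial.Chebyshev.strictAntiOn_node d).injOn (Finset.mem_coe.mpr hi)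
        (Finset.mem_coe.mpr (Finset.mem_erase.mp hj).2) h).symm
  have hinj : Set.InjOn y (Finset.range (d + 1)) := by
    intro i hi j hj hij
    by_contra hne'
    have h1 := hnodepos i hi j (Finset.mem_erase.mpr ⟨Ne.symm hne', hj⟩)
    have h2 := hsep i j
    rw [hij, sub_self, abs_zero] at h2
    nlinarith
  have hdeg : P.degree < (Finset.range (d + 1)).card := by
    rw [Finset.card_range]
    exact lt_of_le_of_lt Polynomial.degree_le_natDegree (by exact_mod_cast Nat.lt_succ_of_le hP)
  have hL : 0 ≤ b - a := by linarith [hx.1, hx.2]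
  have hMnn : 0 ≤ M := (abs_nonneg _).trans (hM _ (hyK 0))
  have hterm : ∀ i ∈ Finset.range (d + 1),
      |P.eval (y i) * (Lagrange.basis (Finset.range (d + 1)) y i).eval x| ≤
      M * ((b - a) ^ d * (2 / s) ^ d * (∏ j ∈ (Finset.range (d + 1)).erase i,
        |Polynomial.Chebyshev.node d i - Polynomial.Chebyshev.node d j|)⁻¹) := by
    intro i hi
    rw [abs_mul]
    refine mul_le_mul (hM _ (hyK i)) ?_ (abs_nonneg _) hMnn
    have hcard : ((Finset.range (d + 1)).erase i).card = d := by
      rw [Finset.card_erase_of_mem hi, Finset.card_range, Nat.add_sub_cancel]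
    calc |(Lagrange.basis (Finset.range (d + 1)) y i).eval x|
        = ∏ j ∈ (Finset.range (d + 1)).erase i, |y i - y j|⁻¹ * |x - y j| := by
          simp [Lagrange.basis, Lagrange.basisDivisor, Polynomial.eval_prod, Finset.abs_prod,
            abs_mul, abs_inv]
      _ ≤ ∏ j ∈ (Finset.range (d + 1)).erase i, ((b - a) * (2 / s) *
            |Polynomial.Chebyshev.node d i - Polynomial.Chebyshev.node d j|⁻¹) := by
          refine Finset.prod_le_prod (fun j _ => by positivity) fun j hj => ?_
          have h1 := hnodepos i hi j hj
          have h2 : |x - y j| ≤ b - a := by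
            have := hKab (hyK j)
            rw [abs_le]
            constructor <;> linarith [hx.1, hx.2, this.1, this.2]
          have h3 : |y i - y j|⁻¹ ≤ (s / 2 *
              |Polynomial.Chebyshev.node d i - Polynomial.Chebyshev.node d j|)⁻¹ :=
            inv_anti₀ (by positivity) (hsep i j)
          calc |y i - y j|⁻¹ * |x - y j| ≤ (s / 2 *
              |Polynomial.Chebyshev.node d i - Polynomial.Chebyshev.node d j|)⁻¹ * (b - a) := by
                gcongr
            _ = _ := by rw [mul_inv, inv_div]; ring
      _ = _ := by
          rw [Finset.prod_mul_distrib, Finset.prod_const, hcard, Finset.prod_inv_distrib, mul_pow]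
  have hpow : (2 : ℝ) ^ (d - 1) = 2 ^ d / 2 := by
    obtain ⟨k, rfl⟩ := Nat.exists_eq_succ_of_ne_zero hd
    simp [pow_succ]
  calc |P.eval x| = |∑ i ∈ Finset.range (d + 1),
        P.eval (y i) * (Lagrange.basis (Finset.range (d + 1)) y i).eval x| := by
        conv_lhs => rw [Lagrange.eq_interpolate hinj hdeg]
        simp [Lagrange.interpolate_apply, Polynomial.eval_finsetSum]
    _ ≤ ∑ i ∈ Finset.range (d + 1), M * ((b - a) ^ d * (2 / s) ^ d *
        (∏ j ∈ (Finset.range (d + 1)).erase i,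
          |Polynomial.Chebyshev.node d i - Polynomial.Chebyshev.node d j|)⁻¹) :=
        (Finset.abs_sum_le_sum_abs _ _).trans (Finset.sum_le_sum hterm)
    _ = (4 * (b - a) / s) ^ d / 2 * M := by
        rw [← Finset.mul_sum, ← Finset.mul_sum, sum_inv_prod_abs_node_sub_node, hpow,
          show 4 * (b - a) / s = (b - a) * (2 / s) * 2 by ring, mul_pow, mul_pow]
        ring

theorem isRemezConstant_four : IsRemezConstant 4 := by
  refine ⟨by norm_num, fun d P hP a b hab E hE hEab hE0 x hx => ?_⟩
  have hEfin : volume E ≠ ⊤ := measure_ne_top_of_subset hEab (by simp)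
  have hs : 0 < volume.real E := ENNReal.toReal_pos hE0.ne' hEfin
  have hbdd : BddAbove ((fun y : ℝ => |P.eval y|) '' E) := by
    refine (isCompact_Icc.image (f := fun y : ℝ => |P.eval y|) ?_).bddAbove.mono
      (Set.image_mono hEab)
    exact (Polynomial.continuous P).abs
  have hM : ∀ y ∈ E, |P.eval y| ≤ sSup ((fun y : ℝ => |P.eval y|) '' E) := fun y hy =>
    le_csSup hbdd ⟨y, hy, rfl⟩
  have hMnn : 0 ≤ sSup ((fun y : ℝ => |P.eval y|) '' E) :=
    Real.sSup_nonneg (by rintro _ ⟨y, -, rfl⟩; exact abs_nonneg _)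
  rcases eq_or_ne d 0 with rfl | hd
  · obtain ⟨y, hy⟩ := nonempty_of_measure_ne_zero hE0.ne'
    rw [Polynomial.eq_C_of_natDegree_le_zero hP] at hM ⊢
    simpa using hM y hy
  -- The factor `1 / 2` in the compact case pays for the passage from `E` to a compact subset.
  obtain ⟨r, hrs, hr0, hr⟩ : ∃ r, r < volume.real E ∧ 0 < r ∧ volume.real E ^ d / 2 < r ^ d := by
    have hcont : Filter.Tendsto (fun r : ℝ => r ^ d) (nhdsWithin (volume.real E) (Set.Iio (volume.real E)))
        (nhds (volume.real E ^ d)) := ((continuous_pow d).tendsto _).mono_left nhdsWithin_le_nhds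
    have h1 := hcont.eventually_const_lt (show volume.real E ^ d / 2 < volume.real E ^ d by
      linarith [pow_pos hs d])
    have h2 := Ioo_mem_nhdsLT hs
    obtain ⟨r, hr1, hr2⟩ := (h1.and h2).exists
    exact ⟨r, hr2.2, hr2.1, hr1⟩
  obtain ⟨K, hKE, hK, hrK⟩ := hE.exists_lt_isCompact
    (show ENNReal.ofReal r < volume E from (ENNReal.ofReal_lt_iff_lt_toReal hr0.le hEfin).mpr hrs)
  have hrK' : r < volume.real K :=
    (ENNReal.ofReal_lt_iff_lt_toReal hr0.le hK.measure_lt_top.ne).mp hrK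
  refine (abs_eval_le_of_isCompact hd hP hK (hKE.trans hEab) (hr0.trans hrK')
    (fun y hy => hM y (hKE hy)) hx).trans ?_
  refine mul_le_mul_of_nonneg_right ?_ hMnn
  have hL : 0 ≤ b - a := by linarith
  calc (4 * (b - a) / volume.real K) ^ d / 2 ≤ (4 * (b - a) / r) ^ d / 2 := by gcongr
    _ = (4 * (b - a)) ^ d / (2 * r ^ d) := by rw [div_pow]; field_simp
    _ ≤ (4 * (b - a)) ^ d / (volume.real E ^ d) := by gcongr; linarith
    _ = _ := by rw [div_pow]

/-! ### The Prékopa–Leindler inequality -/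

/-- Layer-cake formula for functions with values in `ℝ≥0∞`. -/
theorem lintegral_eq_lintegral_measure_ofReal_lt {α : Type*} [MeasurableSpace α] (μ : Measure α)
    [SFinite μ] {f : α → ℝ≥0∞} (hf : Measurable f) :
    ∫⁻ x, f x ∂μ = ∫⁻ u in Set.Ioi (0 : ℝ), μ {x | ENNReal.ofReal u < f x} := by
  have hmeas : MeasurableSet {p : α × ℝ | ENNReal.ofReal p.2 < f p.1} :=
    measurableSet_lt (ENNReal.measurable_ofReal.comp measurable_snd) (hf.comp measurable_fst)
  have hpt : ∀ x, f x = ∫⁻ u in Set.Ioi (0 : ℝ),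
      {p : α × ℝ | ENNReal.ofReal p.2 < f p.1}.indicator (fun _ => 1) (x, u) := by
    intro x
    have hm : MeasurableSet {u : ℝ | ENNReal.ofReal u < f x} :=
      measurableSet_lt ENNReal.measurable_ofReal measurable_const
    have : ∀ u : ℝ, {p : α × ℝ | ENNReal.ofReal p.2 < f p.1}.indicator (fun _ => (1 : ℝ≥0∞)) (x, u)
        = {u : ℝ | ENNReal.ofReal u < f x}.indicator (fun _ => 1) u := fun u => by
      simp [Set.indicator]
    simp_rw [this]
    rw [lintegral_indicator hm, lintegral_const, one_mul, Measure.restrict_apply_univ,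
      Measure.restrict_apply hm]
    by_cases htop : f x = ⊤
    · simp [htop]
    · have : {u : ℝ | ENNReal.ofReal u < f x} ∩ Set.Ioi 0 = Set.Ioo 0 (f x).toReal := by
        ext u
        simp only [Set.mem_inter_iff, Set.mem_ofPred_eq, Set.mem_Ioi, Set.mem_Ioo]
        constructor
        · rintro ⟨h1, h2⟩
          exact ⟨h2, (ENNReal.ofReal_lt_iff_lt_toReal h2.le htop).mp h1⟩
        · rintro ⟨h1, h2⟩
          exact ⟨(ENNReal.ofReal_lt_iff_lt_toReal h1.le htop).mpr h2, h1⟩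
      rw [this, Real.volume_Ioo, sub_zero, ENNReal.ofReal_toReal htop]
  rw [lintegral_congr hpt, lintegral_lintegral_swap]
  · refine lintegral_congr fun u => ?_
    have hm : MeasurableSet {x | ENNReal.ofReal u < f x} := measurableSet_lt measurable_const hf
    have : ∀ x : α, {p : α × ℝ | ENNReal.ofReal p.2 < f p.1}.indicator (fun _ => (1 : ℝ≥0∞)) (x, u)
        = {x | ENNReal.ofReal u < f x}.indicator (fun _ => 1) x := fun x => by
      simp [Set.indicator]
    simp_rw [this]
    rw [lintegral_indicator hm, lintegral_const, one_mul, Measure.restrict_apply_univ]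
  · exact (measurable_const.indicator hmeas).aemeasurable

/-- One-dimensional Brunn–Minkowski inequality for compact sets: two affine images of `A` and `B`
that meet in one point lie inside `C`. -/
theorem measure_add_measure_le_of_isCompact {t : ℝ} (ht0 : 0 < t) (ht1 : t < 1) {A B C : Set ℝ}
    (hA : IsCompact A) (hB : IsCompact B) (hAne : A.Nonempty) (hBne : B.Nonempty)
    (hC : ∀ x ∈ A, ∀ y ∈ B, (1 - t) * x + t * y ∈ C) :
    ENNReal.ofReal (1 - t) * volume A + ENNReal.ofReal t * volume B ≤ volume C := by
  obtain ⟨a, haA, ha⟩ := hA.exists_isGreatest hAne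
  obtain ⟨b, hbB, hb⟩ := hB.exists_isLeast hBne
  have hvol : ∀ (c r : ℝ), 0 < c → ∀ S : Set ℝ,
      volume ((fun x => c * x + r) '' S) = ENNReal.ofReal c * volume S := by
    intro c r hc S
    have : (fun x => c * x + r) '' S = (fun x => x + r) '' (c • S) := by
      rw [← Set.image_smul, Set.image_image]; rfl
    rw [this, Set.image_add_right, measure_preimage_add_right, Measure.addHaar_smul]
    simp [abs_of_pos hc]
  have h1 := hvol (1 - t) (t * b) (by linarith) A
  have h2 := hvol t ((1 - t) * a) ht0 B
  set A' := (fun x => (1 - t) * x + t * b) '' A with hA'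
  set B' := (fun x => t * x + (1 - t) * a) '' B with hB'
  have hB'm : MeasurableSet B' := (hB.image (by fun_prop)).measurableSet
  have hsub : A' ∪ B' ⊆ C := by
    rintro _ (⟨x, hx, rfl⟩ | ⟨y, hy, rfl⟩)
    · exact hC x hx b hbB
    · simpa only [add_comm] using hC a haA y hy
  have hinter : volume (A' ∩ B') = 0 := by
    refine measure_mono_null (t := {(1 - t) * a + t * b}) ?_ (by simp)
    rintro _ ⟨⟨x, hx, rfl⟩, ⟨y, hy, hxy⟩⟩
    have hxa := ha hx
    have hyb := hb hy
    simp only at hxy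
    simp only [Set.mem_singleton_iff]
    nlinarith
  rw [← h1, ← h2, ← measure_union_add_inter A' hB'm, hinter, add_zero]
  exact measure_mono hsub

theorem measure_add_measure_le {t : ℝ} (ht0 : 0 < t) (ht1 : t < 1) {A B C : Set ℝ}
    (hA : MeasurableSet A) (hB : MeasurableSet B) (hAne : A.Nonempty) (hBne : B.Nonempty)
    (hC : ∀ x ∈ A, ∀ y ∈ B, (1 - t) * x + t * y ∈ C) :
    ENNReal.ofReal (1 - t) * volume A + ENNReal.ofReal t * volume B ≤ volume C := by
  have hsup : ∀ S : Set ℝ, MeasurableSet S →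
      volume S = ⨆ K : {K : Set ℝ // K ⊆ S ∧ IsCompact K}, volume K.1 := by
    intro S hS
    rw [hS.measure_eq_iSup_isCompact, iSup_subtype]
    simp_rw [iSup_and]
  have hne : ∀ S : Set ℝ, Nonempty {K : Set ℝ // K ⊆ S ∧ IsCompact K} :=
    fun S => ⟨∅, Set.empty_subset _, isCompact_empty⟩
  have := hne A
  have := hne B
  rw [hsup A hA, hsup B hB, ENNReal.mul_iSup, ENNReal.mul_iSup]
  refine ENNReal.iSup_add_iSup_le fun K L => ?_
  obtain ⟨a, ha⟩ := hAne
  obtain ⟨b, hb⟩ := hBne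
  calc ENNReal.ofReal (1 - t) * volume K.1 + ENNReal.ofReal t * volume L.1
      ≤ ENNReal.ofReal (1 - t) * volume (insert a K.1)
        + ENNReal.ofReal t * volume (insert b L.1) := by
        gcongr <;> exact Set.subset_insert _ _
    _ ≤ volume C := by
        refine measure_add_measure_le_of_isCompact ht0 ht1 (K.2.2.insert a) (L.2.2.insert b)
          (Set.insert_nonempty _ _) (Set.insert_nonempty _ _) fun x hx y hy => hC x ?_ y ?_
        · exact Set.insert_subset ha K.2.1 hx
        · exact Set.insert_subset hb L.2.1 hy

theorem ENNReal.lt_rpow_mul_rpow {a b u : ℝ≥0∞} {t : ℝ} (ht0 : 0 < t) (ht1 : t < 1)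
    (ha : u < a) (hb : u < b) : u < a ^ (1 - t) * b ^ t := by
  have h1 : u ^ (1 - t) < a ^ (1 - t) := ENNReal.rpow_lt_rpow ha (by linarith)
  have h2 : u ^ t < b ^ t := ENNReal.rpow_lt_rpow hb ht0
  calc u = u ^ ((1 - t) + t) := by simp
    _ = u ^ (1 - t) * u ^ t := ENNReal.rpow_add_of_nonneg _ _ (by linarith) ht0.le
    _ < a ^ (1 - t) * b ^ t := ENNReal.mul_lt_mul h1 h2

/-- Weighted arithmetic–geometric mean inequality in `ℝ≥0∞`. -/
theorem ENNReal.rpow_mul_rpow_le_add {t : ℝ} (ht0 : 0 < t) (ht1 : t < 1) (a b : ℝ≥0∞) :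
    a ^ (1 - t) * b ^ t ≤ ENNReal.ofReal (1 - t) * a + ENNReal.ofReal t * b := by
  have ht1' : 0 < 1 - t := by linarith
  rcases eq_or_ne a ⊤ with rfl | ha
  · rw [ENNReal.mul_top (by simpa using ht1)]; simp
  rcases eq_or_ne b ⊤ with rfl | hb
  · rw [ENNReal.mul_top (by simpa using ht0)]; simp
  lift a to NNReal using ha
  lift b to NNReal using hb
  have h := Real.geom_mean_le_arith_mean2_weighted ht1'.le ht0.le a.coe_nonneg b.coe_nonneg (by ring)
  have h' : ENNReal.ofReal ((a : ℝ) ^ (1 - t) * (b : ℝ) ^ t)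
      ≤ ENNReal.ofReal ((1 - t) * a + t * b) := ENNReal.ofReal_le_ofReal h
  rw [ENNReal.ofReal_mul (by positivity), ENNReal.ofReal_add (by positivity) (by positivity),
    ENNReal.ofReal_mul ht1'.le, ENNReal.ofReal_mul ht0.le,
    ← ENNReal.ofReal_rpow_of_nonneg a.coe_nonneg ht1'.le, ← ENNReal.ofReal_rpow_of_nonneg b.coe_nonneg ht0.le] at h'
  simpa using h'

/-- The Prékopa–Leindler inequality on the line, normalized so that both functions have supremum
`1`: then all level sets below `1` are nonempty, and the sum form of Brunn–Minkowski applies. -/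
theorem prekopa_leindler_real_of_iSup_eq_one {t : ℝ} (ht0 : 0 < t) (ht1 : t < 1)
    {f g h : ℝ → ℝ≥0∞} (hf : Measurable f) (hg : Measurable g) (hh : Measurable h)
    (hfs : ⨆ x, f x = 1) (hgs : ⨆ x, g x = 1)
    (H : ∀ x y, f x ^ (1 - t) * g y ^ t ≤ h ((1 - t) * x + t * y)) :
    (∫⁻ x, f x) ^ (1 - t) * (∫⁻ x, g x) ^ t ≤ ∫⁻ x, h x := by
  refine (ENNReal.rpow_mul_rpow_le_add ht0 ht1 _ _).trans ?_
  rw [lintegral_eq_lintegral_measure_ofReal_lt volume hf,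
    lintegral_eq_lintegral_measure_ofReal_lt volume hg,
    lintegral_eq_lintegral_measure_ofReal_lt volume hh,
    ← lintegral_const_mul' _ _ ENNReal.ofReal_ne_top,
    ← lintegral_const_mul' _ _ ENNReal.ofReal_ne_top]
  have hanti : ∀ f : ℝ → ℝ≥0∞, Measurable fun u : ℝ => volume {x | ENNReal.ofReal u < f x} :=
    fun f => Antitone.measurable fun u v huv => measure_mono fun x hx =>
      lt_of_le_of_lt (ENNReal.ofReal_le_ofReal huv) hx
  rw [← lintegral_add_left ((hanti f).const_mul _)]
  refine lintegral_mono fun u => ?_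
  simp only
  rcases lt_or_ge u 1 with hu | hu
  · have hu' : ENNReal.ofReal u < 1 := by simpa using hu
    refine measure_add_measure_le ht0 ht1 (measurableSet_lt measurable_const hf)
      (measurableSet_lt measurable_const hg) ?_ ?_ ?_
    · exact lt_iSup_iff.mp (hfs ▸ hu')
    · exact lt_iSup_iff.mp (hgs ▸ hu')
    · intro x hx y hy
      exact (ENNReal.lt_rpow_mul_rpow ht0 ht1 hx hy).trans_le (H x y)
  · have hempty : ∀ f : ℝ → ℝ≥0∞, ⨆ x, f x = 1 → {x | ENNReal.ofReal u < f x} = ∅ := by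
      intro f hfs
      ext x
      simp only [Set.mem_ofPred_eq, Set.mem_empty_iff_false, iff_false, not_lt]
      refine (le_iSup f x).trans (hfs.le.trans ?_)
      simpa using hu
    rw [hempty f hfs, hempty g hgs]
    simp

/-- Bounded functions are divided by their suprema. -/
theorem prekopa_leindler_real_of_bounded {t : ℝ} (ht0 : 0 < t) (ht1 : t < 1)
    {f g h : ℝ → ℝ≥0∞} (hf : Measurable f) (hg : Measurable g) (hh : Measurable h)
    (hfs : ⨆ x, f x ≠ ⊤) (hgs : ⨆ x, g x ≠ ⊤)
    (H : ∀ x y, f x ^ (1 - t) * g y ^ t ≤ h ((1 - t) * x + t * y)) :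
    (∫⁻ x, f x) ^ (1 - t) * (∫⁻ x, g x) ^ t ≤ ∫⁻ x, h x := by
  have ht1' : 0 < 1 - t := by linarith
  set a := ⨆ x, f x with ha
  set b := ⨆ x, g x with hb
  rcases eq_or_ne a 0 with ha0 | ha0
  · have : ∀ x, f x = 0 := fun x => le_antisymm (ha0 ▸ le_iSup f x) zero_le
    simp [this, ENNReal.zero_rpow_of_pos ht1']
  rcases eq_or_ne b 0 with hb0 | hb0
  · have : ∀ x, g x = 0 := fun x => le_antisymm (hb0 ▸ le_iSup g x) zero_le
    simp [this, ENNReal.zero_rpow_of_pos ht0]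
  have hai : a⁻¹ ≠ ⊤ := ENNReal.inv_ne_top.mpr ha0
  have hbi : b⁻¹ ≠ ⊤ := ENNReal.inv_ne_top.mpr hb0
  have hai0 : a⁻¹ ≠ 0 := ENNReal.inv_ne_zero.mpr hfs
  have hbi0 : b⁻¹ ≠ 0 := ENNReal.inv_ne_zero.mpr hgs
  set c := (a⁻¹) ^ (1 - t) * (b⁻¹) ^ t with hc
  have hc0 : c ≠ 0 := mul_ne_zero (by simp [hai0, hai, ENNReal.rpow_eq_zero_iff])
    (by simp [hbi0, hbi, ENNReal.rpow_eq_zero_iff])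
  have hct : c ≠ ⊤ := ENNReal.mul_ne_top (ENNReal.rpow_ne_top_of_nonneg ht1'.le hai)
    (ENNReal.rpow_ne_top_of_nonneg ht0.le hbi)
  have key := prekopa_leindler_real_of_iSup_eq_one ht0 ht1 (f := fun x => a⁻¹ * f x)
    (g := fun x => b⁻¹ * g x) (h := fun x => c * h x) (hf.const_mul _) (hg.const_mul _)
    (hh.const_mul _) ?_ ?_ ?_
  · rw [lintegral_const_mul' _ _ hai, lintegral_const_mul' _ _ hbi, lintegral_const_mul' _ _ hct,
      ENNReal.mul_rpow_of_nonneg _ _ ht1'.le, ENNReal.mul_rpow_of_nonneg _ _ ht0.le,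
      mul_mul_mul_comm, ← hc] at key
    exact (ENNReal.mul_le_mul_iff_right hc0 hct).mp key
  · rw [← ENNReal.mul_iSup, ← ha, ENNReal.inv_mul_cancel ha0 hfs]
  · rw [← ENNReal.mul_iSup, ← hb, ENNReal.inv_mul_cancel hb0 hgs]
  · intro x y
    rw [ENNReal.mul_rpow_of_nonneg _ _ ht1'.le, ENNReal.mul_rpow_of_nonneg _ _ ht0.le,
      mul_mul_mul_comm, ← hc]
    gcongr
    exact H x y

theorem exists_lt_lintegral_min_natCast {f : ℝ → ℝ≥0∞} (hf : Measurable f) {r : ℝ≥0∞}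
    (hr : r < ∫⁻ x, f x) : ∃ k : ℕ, r < ∫⁻ x, min (f x) k := by
  have hsup : ∫⁻ x, f x = ⨆ k : ℕ, ∫⁻ x, min (f x) k := by
    rw [← lintegral_iSup (fun k => hf.min measurable_const)
      (fun i j hij x => min_le_min_left _ (by exact_mod_cast hij))]
    refine lintegral_congr fun x => ?_
    refine le_antisymm ?_ (iSup_le fun k => min_le_left _ _)
    refine le_of_forall_lt fun y hy => ?_
    obtain ⟨k, hk⟩ := ENNReal.exists_nat_gt (ne_top_of_lt hy)
    exact (lt_min hy hk).trans_le (le_iSup (fun k : ℕ => min (f x) (k : ℝ≥0∞)) k)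
  rw [hsup] at hr
  exact lt_iSup_iff.mp hr

/-- Unbounded functions are truncated. -/
theorem prekopa_leindler_real {t : ℝ} (ht0 : 0 < t) (ht1 : t < 1)
    {f g h : ℝ → ℝ≥0∞} (hf : Measurable f) (hg : Measurable g) (hh : Measurable h)
    (H : ∀ x y, f x ^ (1 - t) * g y ^ t ≤ h ((1 - t) * x + t * y)) :
    (∫⁻ x, f x) ^ (1 - t) * (∫⁻ x, g x) ^ t ≤ ∫⁻ x, h x := by
  have ht1' : 0 < 1 - t := by linarith
  refine ENNReal.mul_le_of_forall_lt fun r hr s hs => ?_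
  rw [← ENNReal.rpow_inv_lt_iff ht1'] at hr
  rw [← ENNReal.rpow_inv_lt_iff ht0] at hs
  obtain ⟨k, hk⟩ := exists_lt_lintegral_min_natCast hf hr
  obtain ⟨l, hl⟩ := exists_lt_lintegral_min_natCast hg hs
  rw [ENNReal.rpow_inv_lt_iff ht1'] at hk
  rw [ENNReal.rpow_inv_lt_iff ht0] at hl
  refine (mul_le_mul' hk.le hl.le).trans (prekopa_leindler_real_of_bounded ht0 ht1
    (hf.min measurable_const) (hg.min measurable_const) hh ?_ ?_ ?_)
  · exact ne_top_of_le_ne_top (ENNReal.natCast_ne_top k) (iSup_le fun x => min_le_right _ _)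
  · exact ne_top_of_le_ne_top (ENNReal.natCast_ne_top l) (iSup_le fun x => min_le_right _ _)
  · intro x y
    refine le_trans ?_ (H x y)
    gcongr <;> exact min_le_left _ _

/-- Tonelli's theorem, slicing along the `i`-th coordinate. -/
theorem lintegral_eq_lintegral_lintegral_insertNth {n : ℕ} (i : Fin (n + 1))
    {f : (Fin (n + 1) → ℝ) → ℝ≥0∞} (hf : Measurable f) :
    ∫⁻ x, f x = ∫⁻ s : ℝ, ∫⁻ y : Fin n → ℝ, f (i.insertNth s y) := by
  have hmp := (volume_preserving_piFinSuccAbove (fun _ : Fin (n + 1) => ℝ) i).symm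
  rw [← hmp.lintegral_comp hf, Measure.volume_eq_prod, lintegral_prod]
  · rfl
  · exact (hf.comp (MeasurableEquiv.measurable _)).aemeasurable

theorem measurable_insertNth {n : ℕ} (i : Fin (n + 1)) :
    Measurable fun p : ℝ × (Fin n → ℝ) => (i.insertNth p.1 p.2 : Fin (n + 1) → ℝ) :=
  (MeasurableEquiv.piFinSuccAbove (fun _ : Fin (n + 1) => ℝ) i).symm.measurable

theorem insertNth_convex_combination {n : ℕ} (i : Fin (n + 1)) (t s s' : ℝ) (y y' : Fin n → ℝ) :
    (1 - t) • (i.insertNth s y : Fin (n + 1) → ℝ) + t • (i.insertNth s' y' : Fin (n + 1) → ℝ) =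
      i.insertNth ((1 - t) * s + t * s') ((1 - t) • y + t • y') := by
  ext j
  refine Fin.succAboveCases i ?_ (fun k => ?_) j
  · simp
  · simp

/-- The Prékopa–Leindler inequality, by induction on the dimension. -/
theorem prekopa_leindler {t : ℝ} (ht0 : 0 < t) (ht1 : t < 1) : ∀ {n : ℕ}
    {f g h : (Fin n → ℝ) → ℝ≥0∞}, Measurable f → Measurable g → Measurable h →
    (∀ x y, f x ^ (1 - t) * g y ^ t ≤ h ((1 - t) • x + t • y)) →
    (∫⁻ x, f x) ^ (1 - t) * (∫⁻ x, g x) ^ t ≤ ∫⁻ x, h x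
  | 0, f, g, h, hf, hg, hh, H => by
    have hdirac : ∀ f : (Fin 0 → ℝ) → ℝ≥0∞, Measurable f → ∫⁻ x, f x = f default := by
      intro f hf
      rw [volume_pi, Measure.pi_of_empty _ default, lintegral_dirac' _ hf]
    rw [hdirac f hf, hdirac g hg, hdirac h hh]
    refine (H default default).trans_eq (congrArg h (Subsingleton.elim _ _))
  | n + 1, f, g, h, hf, hg, hh, H => by
    rw [lintegral_eq_lintegral_lintegral_insertNth 0 hf,
      lintegral_eq_lintegral_lintegral_insertNth 0 hg,
      lintegral_eq_lintegral_lintegral_insertNth 0 hh]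
    have hm := measurable_insertNth (0 : Fin (n + 1))
    refine prekopa_leindler_real ht0 ht1 (hf.comp hm).lintegral_prod_right'
      (hg.comp hm).lintegral_prod_right' (hh.comp hm).lintegral_prod_right' fun s s' => ?_
    refine prekopa_leindler ht0 ht1 (hf.comp (hm.comp measurable_prodMk_left))
      (hg.comp (hm.comp measurable_prodMk_left)) (hh.comp (hm.comp measurable_prodMk_left))
      fun y y' => ?_
    have := H ((0 : Fin (n + 1)).insertNth s y) ((0 : Fin (n + 1)).insertNth s' y')
    rwa [insertNth_convex_combination] at this

/-! ### Log-concave densities on the line -/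

/-- Log-concave integrable densities on the line with bounded support. They arise as marginals of
convex bodies. -/
structure IsLogConcaveDensity (ρ : ℝ → ℝ≥0∞) : Prop where
  measurable : Measurable ρ
  lintegral_ne_top : ∫⁻ x, ρ x ≠ ⊤
  exists_support : ∃ R : ℝ, ∀ x, R < |x| → ρ x = 0
  rpow_mul_rpow_le : ∀ t : ℝ, 0 < t → t < 1 → ∀ x y : ℝ,
    ρ x ^ (1 - t) * ρ y ^ t ≤ ρ ((1 - t) * x + t * y)

theorem nullSingletonClass_withDensity (ρ : ℝ → ℝ≥0∞) :
    NullSingletonClass (volume.withDensity ρ) :=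
  ⟨fun x => withDensity_absolutelyContinuous _ _ (measure_singleton x)⟩

namespace IsLogConcaveDensity

variable {ρ : ℝ → ℝ≥0∞}

theorem isFiniteMeasure (hρ : IsLogConcaveDensity ρ) : IsFiniteMeasure (volume.withDensity ρ) :=
  isFiniteMeasure_withDensity hρ.lintegral_ne_top

theorem min_le (hρ : IsLogConcaveDensity ρ) {x z y : ℝ} (hxz : x ≤ z) (hzy : z ≤ y) :
    min (ρ x) (ρ y) ≤ ρ z := by
  rcases eq_or_lt_of_le hxz with rfl | hxz
  · exact min_le_left _ _
  rcases eq_or_lt_of_le hzy with rfl | hzy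
  · exact min_le_right _ _
  have hxy : 0 < y - x := by linarith
  set t := (z - x) / (y - x) with ht
  have ht0 : 0 < t := div_pos (by linarith) hxy
  have ht1 : t < 1 := (div_lt_one hxy).mpr (by linarith)
  have hz : (1 - t) * x + t * y = z := by
    have : t * (y - x) = z - x := div_mul_cancel₀ _ hxy.ne'
    linarith
  calc min (ρ x) (ρ y) = min (ρ x) (ρ y) ^ (1 - t) * min (ρ x) (ρ y) ^ t := by
        rw [← ENNReal.rpow_add_of_nonneg _ _ (by linarith) ht0.le]; simp
    _ ≤ ρ x ^ (1 - t) * ρ y ^ t := by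
        gcongr
        · exact min_le_left _ _
        · exact min_le_right _ _
    _ ≤ ρ z := hz ▸ hρ.rpow_mul_rpow_le t ht0 ht1 x y

theorem comp_neg (hρ : IsLogConcaveDensity ρ) : IsLogConcaveDensity fun x => ρ (-x) where
  measurable := hρ.measurable.comp measurable_neg
  lintegral_ne_top := by
    rw [lintegral_neg_eq_self (μ := volume) (f := ρ)]
    exact hρ.lintegral_ne_top
  exists_support := by
    obtain ⟨R, hR⟩ := hρ.exists_support
    exact ⟨R, fun x hx => hR _ (by rwa [abs_neg])⟩
  rpow_mul_rpow_le := fun t ht0 ht1 x y => by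
    have := hρ.rpow_mul_rpow_le t ht0 ht1 (-x) (-y)
    rwa [show (1 - t) * -x + t * -y = -((1 - t) * x + t * y) by ring] at this

theorem indicator (hρ : IsLogConcaveDensity ρ) {S : Set ℝ} (hS : MeasurableSet S)
    (hSc : Convex ℝ S) : IsLogConcaveDensity (S.indicator ρ) where
  measurable := hρ.measurable.indicator hS
  lintegral_ne_top :=
    ne_top_of_le_ne_top hρ.lintegral_ne_top (lintegral_mono (Set.indicator_le_self S ρ))
  exists_support := by
    obtain ⟨R, hR⟩ := hρ.exists_support
    refine ⟨R, fun x hx => ?_⟩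
    simp [hR x hx]
  rpow_mul_rpow_le := fun t ht0 ht1 x y => by
    by_cases hx : x ∈ S
    · by_cases hy : y ∈ S
      · have hz : (1 - t) * x + t * y ∈ S := hSc hx hy (by linarith) ht0.le (by ring)
        simpa [hx, hy, hz] using hρ.rpow_mul_rpow_le t ht0 ht1 x y
      · simp [hy, ENNReal.zero_rpow_of_pos ht0]
    · simp [hx, ENNReal.zero_rpow_of_pos (show 0 < 1 - t by linarith)]

theorem withDensity_indicator_real {S T : Set ℝ} (hS : MeasurableSet S) (hT : MeasurableSet T) :
    (volume.withDensity (S.indicator ρ)).real T = (volume.withDensity ρ).real (T ∩ S) := by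
  rw [measureReal_def, measureReal_def, withDensity_indicator hS, withDensity_apply _ hT,
    withDensity_apply _ (hT.inter hS), Measure.restrict_restrict hT]

theorem withDensity_comp_neg_real {T : Set ℝ} (hT : MeasurableSet T) :
    (volume.withDensity fun x => ρ (-x)).real T = (volume.withDensity ρ).real (-T) := by
  rw [measureReal_def, measureReal_def, withDensity_apply _ hT, withDensity_apply _ hT.neg,
    ← lintegral_indicator hT, ← lintegral_indicator hT.neg,
    ← lintegral_neg_eq_self (f := (-T).indicator ρ)]
  refine congrArg ENNReal.toReal (lintegral_congr fun x => ?_)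
  by_cases hx : x ∈ T
  · rw [Set.indicator_of_mem hx, Set.indicator_of_mem (Set.neg_mem_neg.mpr hx)]
  · rw [Set.indicator_of_notMem hx, Set.indicator_of_notMem fun h => hx (Set.neg_mem_neg.mp h)]

/-- The tails of a log-concave measure are log-concave, by the Prékopa–Leindler inequality. -/
theorem measureReal_Ici_rpow_mul_le (hρ : IsLogConcaveDensity ρ) {t : ℝ} (ht0 : 0 < t) (ht1 : t < 1)
    (x y : ℝ) :
    (volume.withDensity ρ).real (Set.Ici x) ^ (1 - t) *
      (volume.withDensity ρ).real (Set.Ici y) ^ t ≤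
    (volume.withDensity ρ).real (Set.Ici ((1 - t) * x + t * y)) := by
  have := hρ.isFiniteMeasure
  have h1t : 0 < 1 - t := by linarith
  have key := prekopa_leindler_real ht0 ht1 (hρ.measurable.indicator (measurableSet_Ici (a := x)))
    (hρ.measurable.indicator (measurableSet_Ici (a := y)))
    (hρ.measurable.indicator (measurableSet_Ici (a := (1 - t) * x + t * y))) ?_
  · simp_rw [lintegral_indicator measurableSet_Ici, ← withDensity_apply _ measurableSet_Ici] at key
    have h2 := ENNReal.toReal_mono (measure_ne_top _ _) key
    rwa [ENNReal.toReal_mul, ← ENNReal.toReal_rpow, ← ENNReal.toReal_rpow] at h2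
  · intro u v
    by_cases hu : u ∈ Set.Ici x
    · by_cases hv : v ∈ Set.Ici y
      · have hw : (1 - t) * u + t * v ∈ Set.Ici ((1 - t) * x + t * y) := by
          simp only [Set.mem_Ici] at *
          gcongr
        simpa only [Set.indicator_of_mem, hu, hv, hw] using hρ.rpow_mul_rpow_le t ht0 ht1 u v
      · simp only [Set.indicator_of_notMem hv, ENNReal.zero_rpow_of_pos ht0, mul_zero, zero_le]
    · simp only [Set.indicator_of_notMem hu, ENNReal.zero_rpow_of_pos h1t, zero_mul, zero_le]

/-- There is a point `p ≤ β` such that every superlevel set of `ρ` on `(-∞, β]` either lies in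
`[p, q]` or contains `(p, q)`, where `q` divides `[p, β]` in the ratio `t : 1 - t`. The point is
the last one that can be outweighed by a point beyond its own dividing point. -/
theorem exists_dividing_point (hρ : IsLogConcaveDensity ρ) {t β : ℝ} (ht0 : 0 < t) (ht1 : t < 1)
    (hβ : ∃ y < β, ρ y ≠ 0) :
    ∃ p ≤ β, (∀ h : ℝ≥0∞, ∀ x < p, h < ρ x → ∀ z ∈ Set.Ioo x (p + t * (β - p)), h < ρ z) ∧
      (∀ h : ℝ≥0∞, ∀ y ≤ β, p + t * (β - p) < y → h < ρ y →
        ∀ z ∈ Set.Ioo p (p + t * (β - p)), h < ρ z) := by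
  set T := {x | x ≤ β ∧ ∃ y ≤ β, x + t * (β - x) < y ∧ ρ x < ρ y} with hT
  have hTb : BddAbove T := ⟨β, fun x hx => hx.1⟩
  have hTne : T.Nonempty := by
    obtain ⟨y, hy, hy0⟩ := hβ
    obtain ⟨R, hR⟩ := hρ.exists_support
    obtain ⟨x, hx⟩ := exists_lt (min (min (-|R|) β) ((y - t * β) / (1 - t)))
    rw [lt_min_iff, lt_min_iff, lt_div_iff₀ (by linarith)] at hx
    refine ⟨x, hx.1.2.le, y, hy.le, by linarith [hx.2], ?_⟩
    have hxR : R < |x| := by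
      have := le_abs_self R
      have := neg_le_abs x
      linarith [hx.1.1]
    rw [hR x hxR]
    exact pos_iff_ne_zero.mpr hy0
  set p := sSup T with hp
  have hpβ : p ≤ β := csSup_le hTne fun x hx => hx.1
  have hmono : ∀ {x y : ℝ}, x ≤ y → x + t * (β - x) ≤ y + t * (β - y) := fun h => by nlinarith
  refine ⟨p, hpβ, ?_, ?_⟩
  · intro h x hx hhx z hz
    by_contra! hcon
    -- A point of `T` close to `p` whose dividing point exceeds `z`.
    obtain ⟨x', hx', hlt⟩ := exists_lt_of_lt_csSup hTne
      (show max x (p - (p + t * (β - p) - z)) < p from max_lt hx (by linarith [hz.2]))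
    obtain ⟨hxx', hx'2⟩ := max_lt_iff.mp hlt
    obtain ⟨hx'β, y, hyβ, hxy, hρxy⟩ := hx'
    have hx'p : x' ≤ p := le_csSup hTb ⟨hx'β, y, hyβ, hxy, hρxy⟩
    have hzy : z < y := by nlinarith
    have hyz : ρ y ≤ ρ z := by
      have := hρ.min_le hz.1.le hzy.le
      rcases min_le_iff.mp this with h1 | h1
      · exact absurd (hhx.trans_le h1) (not_lt.mpr hcon)
      · exact h1
    have hx'y : x' ≤ y := by nlinarith
    have hle : ρ y ≤ ρ x' := by
      rcases le_total x' z with hle | hle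
      · rcases min_le_iff.mp (hρ.min_le hxx'.le hle) with h1 | h1
        · exact hyz.trans (hcon.trans (hhx.le.trans h1))
        · exact hyz.trans h1
      · rcases min_le_iff.mp (hρ.min_le hle hx'y) with h1 | h1
        · exact hyz.trans h1
        · exact h1
    exact absurd hρxy (not_lt.mpr hle)
  · intro h y hyβ hqy hhy z hz
    -- A point between `p` and `z` whose dividing point is below `y`; it is not in `T`.
    set w := min z (p + (y - (p + t * (β - p))) / 2) with hw
    have hpw : p < w := lt_min hz.1 (by linarith)
    have hw2 : w ≤ p + (y - (p + t * (β - p))) / 2 := min_le_right _ _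
    have hwz : w ≤ z := min_le_left _ _
    have hzy : z ≤ y := hz.2.le.trans hqy.le
    have hwT : w ∉ T := fun hmem => absurd (le_csSup hTb hmem) (not_le.mpr hpw)
    have hwy : ρ y ≤ ρ w := by
      by_contra! hlt
      exact hwT ⟨by linarith, y, hyβ, by nlinarith, hlt⟩
    exact lt_of_lt_of_le (lt_min (hhy.trans_le hwy) hhy) (hρ.min_le hwz hzy)

/-- Estimate for a single superlevel set `L` of the density. If `L` contains `(p, q)`, the sparsity
of `H` is used on the segment from the infimum of `L` to `β`. -/
theorem volume_layer_le {t β p : ℝ} (ht0 : 0 < t) (hpβ : p ≤ β)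
    {H : Set ℝ} (hH : ∀ s ≤ β, volume (H ∩ Set.Icc s β) ≤ ENNReal.ofReal (t * (β - s)))
    {L : Set ℝ} (hL : BddBelow L)
    (h1 : ∀ x < p, x ∈ L → Set.Ioo x (p + t * (β - p)) ⊆ L)
    (h2 : ∀ y ≤ β, p + t * (β - p) < y → y ∈ L → Set.Ioo p (p + t * (β - p)) ⊆ L) :
    volume (L ∩ (H ∩ Set.Iic β)) ≤
      ENNReal.ofReal t * volume (L ∩ Set.Iic p) + volume (L ∩ Set.Icc p (p + t * (β - p))) := by
  set q := p + t * (β - p) with hq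
  have hpq : p ≤ q := by nlinarith
  by_cases hsub : L ∩ Set.Iic β ⊆ Set.Icc p q
  · have : L ∩ (H ∩ Set.Iic β) ⊆ L ∩ Set.Icc p q := fun x hx => ⟨hx.1, hsub ⟨hx.1, hx.2.2⟩⟩
    exact (measure_mono this).trans le_add_self
  have hpqL : Set.Ioo p q ⊆ L := by
    obtain ⟨y, ⟨hyL, hyβ⟩, hy⟩ := Set.not_subset.mp hsub
    rcases lt_or_ge y p with hyp | hyp
    · exact (Set.Ioo_subset_Ioo_left hyp.le).trans (h1 y hyp hyL)
    · exact h2 y hyβ (not_le.mp fun hle => hy ⟨hyp, hle⟩) hyL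
  have hbdd : BddBelow (insert p (L ∩ Set.Iic β)) := (hL.mono Set.inter_subset_left).insert p
  have hne : (insert p (L ∩ Set.Iic β)).Nonempty := Set.insert_nonempty _ _
  set l := sInf (insert p (L ∩ Set.Iic β)) with hl
  have hlp : l ≤ p := csInf_le hbdd (Set.mem_insert _ _)
  have hlL : Set.Ioo l p ⊆ L ∩ Set.Iic p := by
    rintro x ⟨hlx, hxp⟩
    obtain ⟨x', hx', hlt⟩ := exists_lt_of_csInf_lt hne hlx
    rcases hx' with rfl | ⟨hx'L, -⟩
    · exact absurd hxp hlt.not_gt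
    · exact ⟨h1 x' (hlt.trans hxp) hx'L ⟨hlt, hxp.trans_le hpq⟩, hxp.le⟩
  calc volume (L ∩ (H ∩ Set.Iic β)) ≤ volume (H ∩ Set.Icc l β) :=
        measure_mono fun x hx => ⟨hx.2.1, csInf_le hbdd (Or.inr ⟨hx.1, hx.2.2⟩), hx.2.2⟩
    _ ≤ ENNReal.ofReal (t * (β - l)) := hH l (hlp.trans hpβ)
    _ = ENNReal.ofReal t * ENNReal.ofReal (p - l) + ENNReal.ofReal (q - p) := by
        rw [← ENNReal.ofReal_mul ht0.le, ← ENNReal.ofReal_add (by nlinarith) (by linarith)]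
        congr 1
        rw [hq]; ring
    _ = ENNReal.ofReal t * volume (Set.Ioo l p) + volume (Set.Ioo p q) := by
        rw [Real.volume_Ioo, Real.volume_Ioo]
    _ ≤ _ := by
        gcongr
        exact fun x hx => ⟨hpqL hx, hx.1.le, hx.2.le⟩

theorem withDensity_eq_lintegral_layers (hρ : IsLogConcaveDensity ρ) {A : Set ℝ}
    (hA : MeasurableSet A) :
    volume.withDensity ρ A =
      ∫⁻ u in Set.Ioi (0 : ℝ), volume ({x | ENNReal.ofReal u < ρ x} ∩ A) := by
  rw [withDensity_apply _ hA, lintegral_eq_lintegral_measure_ofReal_lt _ hρ.measurable]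
  refine lintegral_congr fun u => ?_
  rw [Measure.restrict_apply (measurableSet_lt measurable_const hρ.measurable)]

/-- Integration over the layers: a set that is sparse as seen from `β` has no more mass than the
fraction `t` of `(-∞, p]` together with all of `[p, q]`. -/
theorem exists_withDensity_le (hρ : IsLogConcaveDensity ρ) {t β : ℝ} (ht0 : 0 < t) (ht1 : t < 1)
    {H : Set ℝ} (hHm : MeasurableSet H)
    (hH : ∀ s ≤ β, volume (H ∩ Set.Icc s β) ≤ ENNReal.ofReal (t * (β - s))) :
    ∃ p ≤ β, volume.withDensity ρ (H ∩ Set.Iic β) ≤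
      ENNReal.ofReal t * volume.withDensity ρ (Set.Iic p) +
        volume.withDensity ρ (Set.Icc p (p + t * (β - p))) := by
  by_cases hβ : ∃ y < β, ρ y ≠ 0
  · obtain ⟨p, hpβ, h1, h2⟩ := hρ.exists_dividing_point ht0 ht1 hβ
    refine ⟨p, hpβ, ?_⟩
    rw [hρ.withDensity_eq_lintegral_layers (hHm.inter measurableSet_Iic),
      hρ.withDensity_eq_lintegral_layers measurableSet_Iic,
      hρ.withDensity_eq_lintegral_layers measurableSet_Icc,
      ← lintegral_const_mul' _ _ ENNReal.ofReal_ne_top, ← lintegral_add_left]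
    · refine lintegral_mono fun u => volume_layer_le ht0 hpβ hH ?_ (fun x hx hxL => ?_)
        (fun y hy hqy hyL => ?_)
      · obtain ⟨R, hR⟩ := hρ.exists_support
        refine ⟨-R, fun x hx => ?_⟩
        by_contra! hlt
        have : R < |x| := by linarith [neg_le_abs x]
        simp [hR x this] at hx
      · exact h1 _ x hx hxL
      · exact h2 _ y hy hqy hyL
    · refine Measurable.const_mul (Antitone.measurable fun u v huv => ?_) _
      exact measure_mono (Set.inter_subset_inter_left _ fun x hx =>
        lt_of_le_of_lt (ENNReal.ofReal_le_ofReal huv) hx)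
  · push Not at hβ
    refine ⟨β, le_rfl, ?_⟩
    have h0 : volume.withDensity ρ (H ∩ Set.Iic β) = 0 := by
      have hn := nullSingletonClass_withDensity ρ
      refine measure_mono_null Set.inter_subset_right ?_
      rw [measure_congr Iio_ae_eq_Iic.symm, withDensity_apply _ measurableSet_Iio,
        setLIntegral_congr_fun measurableSet_Iio hβ]
      simp
    rw [h0]
    exact zero_le

/-- One-sided case of the one-dimensional inequality: `H` is sparse as seen from the point `β`. -/
theorem measureReal_inter_Iic_le (hρ : IsLogConcaveDensity ρ) {t β : ℝ} (ht0 : 0 < t) (ht1 : t < 1)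
    {H : Set ℝ} (hHm : MeasurableSet H)
    (hH : ∀ s ≤ β, volume (H ∩ Set.Icc s β) ≤ ENNReal.ofReal (t * (β - s))) :
    (volume.withDensity ρ).real (H ∩ Set.Iic β) ≤
      (volume.withDensity ρ).real Set.univ - (volume.withDensity ρ).real Set.univ ^ (1 - t) *
        (volume.withDensity ρ).real (Set.Ici β) ^ t := by
  have := hρ.isFiniteMeasure
  have hn := nullSingletonClass_withDensity ρ
  obtain ⟨p, hpβ, hp⟩ := hρ.exists_withDensity_le ht0 ht1 hHm hH
  set q := p + t * (β - p) with hq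
  have hpq : p ≤ q := by nlinarith
  set ν := volume.withDensity ρ with hν
  have hp' : ν.real (H ∩ Set.Iic β) ≤ t * ν.real (Set.Iic p) + ν.real (Set.Icc p q) := by
    have h := ENNReal.toReal_mono (by finiteness) hp
    rwa [ENNReal.toReal_add (by finiteness) (by finiteness), ENNReal.toReal_mul,
      ENNReal.toReal_ofReal ht0.le] at h
  have h1 : ν.real (Set.Iic p) = ν.real Set.univ - ν.real (Set.Ici p) := by
    rw [← measureReal_add_measureReal_compl (μ := ν) (measurableSet_Ici (a := p)), Set.compl_Ici,
      measureReal_congr (μ := ν) Iio_ae_eq_Iic]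
    ring
  have h2 : ν.real (Set.Icc p q) = ν.real (Set.Ici p) - ν.real (Set.Ici q) := by
    rw [← measureReal_sdiff (Set.Ici_subset_Ici.mpr hpq) measurableSet_Ici, Set.Ici_sdiff_Ici,
      measureReal_congr (μ := ν) Ico_ae_eq_Icc]
  have h3 := hρ.measureReal_Ici_rpow_mul_le ht0 ht1 p β
  rw [show (1 - t) * p + t * β = q by rw [hq]; ring] at h3
  have hxb : ν.real (Set.Ici β) ≤ ν.real (Set.Ici p) :=
    measureReal_mono (Set.Ici_subset_Ici.mpr hpβ)
  have hbM : ν.real (Set.Ici p) ≤ ν.real Set.univ := measureReal_mono (Set.subset_univ _)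
  have hx0 : 0 ≤ ν.real (Set.Ici β) := measureReal_nonneg
  change ν.real (Set.Ici p) ^ (1 - t) * ν.real (Set.Ici β) ^ t ≤ _ at h3
  generalize ν.real (Set.Ici p) = b at *
  generalize ν.real (Set.Ici q) = c at *
  generalize ν.real (Set.Ici β) = x at *
  generalize ν.real Set.univ = M at *
  have hb0 : 0 ≤ b := hx0.trans hxb
  have hM0 : 0 ≤ M := hb0.trans hbM
  have h4 : b ^ (1 - t) ≤ M ^ (1 - t) := Real.rpow_le_rpow hb0 hbM (by linarith)
  have h5 : x ^ t ≤ b ^ t := Real.rpow_le_rpow hx0 hxb ht0.le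
  have h6 : M ^ (1 - t) * b ^ t ≤ (1 - t) * M + t * b :=
    Real.geom_mean_le_arith_mean2_weighted (by linarith) ht0.le hM0 hb0 (by ring)
  have h7 : b ^ (1 - t) * b ^ t = b := by
    rw [← Real.rpow_add_of_nonneg hb0 (by linarith) ht0.le]; simp
  nlinarith [mul_nonneg (sub_nonneg.mpr h4) (sub_nonneg.mpr h5)]

end IsLogConcaveDensity

/-! ### The dilation inequality on the line -/

namespace IsLogConcaveDensity

variable {ρ : ℝ → ℝ≥0∞}

theorem measureReal_inter_Ici_le (hρ : IsLogConcaveDensity ρ) {t α : ℝ} (ht0 : 0 < t) (ht1 : t < 1)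
    {H : Set ℝ} (hHm : MeasurableSet H)
    (hH : ∀ s, α ≤ s → volume (H ∩ Set.Icc α s) ≤ ENNReal.ofReal (t * (s - α))) :
    (volume.withDensity ρ).real (H ∩ Set.Ici α) ≤
      (volume.withDensity ρ).real Set.univ - (volume.withDensity ρ).real Set.univ ^ (1 - t) *
        (volume.withDensity ρ).real (Set.Iic α) ^ t := by
  have h := hρ.comp_neg.measureReal_inter_Iic_le (β := -α) ht0 ht1 hHm.neg fun s hs => ?_
  · rw [withDensity_comp_neg_real (hHm.neg.inter measurableSet_Iic),
      withDensity_comp_neg_real MeasurableSet.univ, withDensity_comp_neg_real measurableSet_Ici] at h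
    simpa using h
  · have h1 := hH (-s) (by linarith)
    rw [← Measure.measure_neg] at h1
    rw [show t * (-α - s) = t * (-s - α) by ring]
    simpa using h1

theorem continuous_measureReal_Iic (hρ : IsLogConcaveDensity ρ) :
    Continuous fun z => (volume.withDensity ρ).real (Set.Iic z) := by
  have := hρ.isFiniteMeasure
  have hn := nullSingletonClass_withDensity ρ
  refine continuous_iff_continuousAt.mpr fun z => ?_
  refine (ENNReal.continuousAt_toReal (measure_ne_top _ _)).tendsto.comp
    (tendsto_measure_of_ae_tendsto_indicator_of_isFiniteMeasure (𝓝 z) measurableSet_Iic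
      (fun _ => measurableSet_Iic) ?_)
  have hz : ∀ᵐ x ∂(volume.withDensity ρ), x ≠ z := by
    simp [ae_iff]
  filter_upwards [hz] with x hx
  rcases lt_or_gt_of_ne hx with h | h
  · filter_upwards [lt_mem_nhds h] with w hw
    simp [h.le, hw.le]
  · filter_upwards [gt_mem_nhds h] with w hw
    exact ⟨fun hle => absurd hle (not_le.mpr hw), fun hle => absurd hle (not_le.mpr h)⟩

/-- Two-sided case of the one-dimensional inequality. The line is cut at a point that divides the
total mass in the same proportion as the masses outside `(α, β)`, and the one-sided case is applied
to both parts. -/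
theorem measureReal_inter_Icc_le (hρ : IsLogConcaveDensity ρ) {t α β : ℝ} (ht0 : 0 < t)
    (ht1 : t < 1) (hαβ : α < β) {H : Set ℝ} (hHm : MeasurableSet H)
    (hα : ∀ s, α ≤ s → volume (H ∩ Set.Icc α s) ≤ ENNReal.ofReal (t * (s - α)))
    (hβ : ∀ s ≤ β, volume (H ∩ Set.Icc s β) ≤ ENNReal.ofReal (t * (β - s))) :
    (volume.withDensity ρ).real (H ∩ Set.Icc α β) ≤
      (volume.withDensity ρ).real Set.univ - (volume.withDensity ρ).real Set.univ ^ (1 - t) *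
        ((volume.withDensity ρ).real (Set.Iic α) + (volume.withDensity ρ).real (Set.Ici β)) ^ t := by
  have := hρ.isFiniteMeasure
  have hn := nullSingletonClass_withDensity ρ
  have hcompl : ∀ z, (volume.withDensity ρ).real (Set.Iic z) +
      (volume.withDensity ρ).real (Set.Ici z) = (volume.withDensity ρ).real Set.univ := fun z => by
    rw [← measureReal_add_measureReal_compl (μ := volume.withDensity ρ) (measurableSet_Iic (a := z)),
      Set.compl_Iic, measureReal_congr (Ioi_ae_eq_Ici (μ := volume.withDensity ρ))]
  have hL := fun z => (hρ.indicator (measurableSet_Iic (a := z))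
    (convex_Iic z)).measureReal_inter_Ici_le ht0 ht1 hHm hα
  have hR := fun z => (hρ.indicator (measurableSet_Ici (a := z))
    (convex_Ici z)).measureReal_inter_Iic_le ht0 ht1 hHm hβ
  simp_rw [withDensity_indicator_real measurableSet_Iic (hHm.inter measurableSet_Ici),
    withDensity_indicator_real measurableSet_Iic measurableSet_Iic,
    withDensity_indicator_real measurableSet_Iic MeasurableSet.univ, Set.univ_inter] at hL
  simp_rw [withDensity_indicator_real measurableSet_Ici (hHm.inter measurableSet_Iic),
    withDensity_indicator_real measurableSet_Ici measurableSet_Ici,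
    withDensity_indicator_real measurableSet_Ici MeasurableSet.univ, Set.univ_inter] at hR
  have hcont := hρ.continuous_measureReal_Iic
  set ν := volume.withDensity ρ with hν
  set M := ν.real Set.univ with hM
  set A := ν.real (Set.Iic α) with hA
  set B := ν.real (Set.Ici β) with hB
  have hA0 : 0 ≤ A := measureReal_nonneg
  have hB0 : 0 ≤ B := measureReal_nonneg
  have hABM : A + B ≤ M := by
    have : A ≤ ν.real (Set.Iic β) := measureReal_mono (Set.Iic_subset_Iic.mpr hαβ.le)
    linarith [hcompl β]
  rcases eq_or_lt_of_le (add_nonneg hA0 hB0) with h0 | hpos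
  · rw [← h0, Real.zero_rpow ht0.ne', mul_zero, sub_zero]
    exact measureReal_mono (Set.subset_univ _)
  have hMpos : 0 < M := hpos.trans_le hABM
  obtain ⟨z, ⟨hαz, hzβ⟩, hz⟩ := intermediate_value_Icc hαβ.le hcont.continuousOn
    (show M * (A / (A + B)) ∈ Set.Icc (ν.real (Set.Iic α)) (ν.real (Set.Iic β)) by
      rw [← hA, show ν.real (Set.Iic β) = M - B by linarith [hcompl β], Set.mem_Icc, ← mul_div_assoc,
        le_div_iff₀ hpos, div_le_iff₀ hpos]
      constructor <;> nlinarith)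
  have hz2 : ν.real (Set.Ici z) = M * (B / (A + B)) := by
    have := hcompl z
    simp only at hz
    have h1 : M * (A / (A + B)) + M * (B / (A + B)) = M := by field_simp
    linarith
  have e1 : Set.Iic α ∩ Set.Iic z = Set.Iic α := Set.inter_eq_left.mpr (Set.Iic_subset_Iic.mpr hαz)
  have e2 : Set.Ici β ∩ Set.Ici z = Set.Ici β := Set.inter_eq_left.mpr (Set.Ici_subset_Ici.mpr hzβ)
  have hLz := hL z
  have hRz := hR z
  simp only at hz
  rw [e1, hz] at hLz
  rw [e2, hz2] at hRz
  have hscale : ∀ a, 0 ≤ a → (M * (a / (A + B))) ^ (1 - t) * a ^ t =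
      a / (A + B) * (M ^ (1 - t) * (A + B) ^ t) := by
    intro a ha
    have h1 : (a / (A + B)) ^ (1 - t) * (a / (A + B)) ^ t = a / (A + B) := by
      rw [← Real.rpow_add_of_nonneg (by positivity) (by linarith) ht0.le]; simp
    have h2 : a ^ t = (a / (A + B)) ^ t * (A + B) ^ t := by
      rw [← Real.mul_rpow (by positivity) hpos.le, div_mul_cancel₀ _ hpos.ne']
    rw [Real.mul_rpow hMpos.le (by positivity), h2]
    linear_combination (M ^ (1 - t) * (A + B) ^ t) * h1
  rw [← hA, hscale A hA0] at hLz
  rw [← hB, hscale B hB0] at hRz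
  have hsub : H ∩ Set.Icc α β ⊆
      (H ∩ Set.Ici α ∩ Set.Iic z) ∪ (H ∩ Set.Iic β ∩ Set.Ici z) := by
    rintro x ⟨hxH, hxα, hxβ⟩
    rcases le_total x z with h | h
    · exact Or.inl ⟨⟨hxH, hxα⟩, h⟩
    · exact Or.inr ⟨⟨hxH, hxβ⟩, h⟩
  calc ν.real (H ∩ Set.Icc α β)
      ≤ ν.real (H ∩ Set.Ici α ∩ Set.Iic z) + ν.real (H ∩ Set.Iic β ∩ Set.Ici z) :=
        (measureReal_mono hsub).trans (measureReal_union_le _ _)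
    _ ≤ (M * (A / (A + B)) - A / (A + B) * (M ^ (1 - t) * (A + B) ^ t)) +
        (M * (B / (A + B)) - B / (A + B) * (M ^ (1 - t) * (A + B) ^ t)) := add_le_add hLz hRz
    _ = M - M ^ (1 - t) * (A + B) ^ t := by field_simp

end IsLogConcaveDensity

/-- Concavity of the power function at four points with equal sums. -/
theorem rpow_add_rpow_le_of_add_le {M u v t : ℝ} (ht0 : 0 ≤ t) (ht1 : t ≤ 1) (hu : 0 ≤ u)
    (hv : 0 ≤ v) (huv : u + v ≤ M) :
    M ^ t + (M - (u + v)) ^ t ≤ (M - u) ^ t + (M - v) ^ t := by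
  rcases eq_or_lt_of_le (add_nonneg hu hv) with h0 | hpos
  · have hu0 : u = 0 := by linarith
    have hv0 : v = 0 := by linarith
    simp [hu0, hv0]
  have hc := Real.concaveOn_rpow ht0 ht1
  have hM : M ∈ Set.Ici (0 : ℝ) := by simp only [Set.mem_Ici]; linarith
  have hm : M - (u + v) ∈ Set.Ici (0 : ℝ) := by simp only [Set.mem_Ici]; linarith
  have hsum : v / (u + v) + u / (u + v) = 1 := by rw [← add_div, add_comm v u, div_self hpos.ne']
  have hu' : 0 ≤ u / (u + v) := by positivity
  have hv' : 0 ≤ v / (u + v) := by positivity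
  have h1 := hc.2 hM hm hv' hu' hsum
  have h2 := hc.2 hM hm hu' hv' ((add_comm _ _).trans hsum)
  simp only [smul_eq_mul] at h1 h2
  rw [show v / (u + v) * M + u / (u + v) * (M - (u + v)) = M - u by field_simp; ring] at h1
  rw [show u / (u + v) * M + v / (u + v) * (M - (u + v)) = M - v by field_simp; ring] at h2
  have h3 : (v / (u + v) + u / (u + v)) * (M ^ t + (M - (u + v)) ^ t) =
    M ^ t + (M - (u + v)) ^ t := by rw [hsum, one_mul]
  nlinarith

/-- The function `u ↦ M - M ^ (1 - t) * (M - u) ^ t` is superadditive, being convex and zero at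
the origin. -/
theorem sum_sub_rpow_mul_rpow_le {ι : Type*} (s : Finset ι) {u : ι → ℝ} (hu : ∀ i, 0 ≤ u i)
    {M t : ℝ} (hM : 0 ≤ M) (ht0 : 0 < t) (ht1 : t < 1) (hs : ∑ i ∈ s, u i ≤ M) :
    ∑ i ∈ s, (M - M ^ (1 - t) * (M - u i) ^ t) ≤
      M - M ^ (1 - t) * (M - ∑ i ∈ s, u i) ^ t := by
  have hMM : M ^ (1 - t) * M ^ t = M := by
    rw [← Real.rpow_add_of_nonneg hM (by linarith) ht0.le]; simp
  classical
  induction s using Finset.induction_on with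
  | empty => simp [hMM]
  | insert a s ha ih =>
    rw [Finset.sum_insert ha] at hs
    rw [Finset.sum_insert ha, Finset.sum_insert ha]
    have h1 := ih (by linarith [hu a])
    have h2 := rpow_add_rpow_le_of_add_le ht0.le ht1.le (hu a)
      (Finset.sum_nonneg fun i _ => hu i) hs
    have h3 := mul_le_mul_of_nonneg_left h2 (Real.rpow_nonneg hM (1 - t))
    linarith

namespace IsLogConcaveDensity

variable {ρ : ℝ → ℝ≥0∞}

/-- The estimate in one component of the complement of `G`: it has one or two end points in `G`, from
which `H` is sparse. -/
theorem ordConnectedComponent_le (hρ : IsLogConcaveDensity ρ) {t : ℝ} (ht0 : 0 < t) (ht1 : t < 1)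
    {G H : Set ℝ} (hG : IsClosed G) (hGne : G.Nonempty) (hHm : MeasurableSet H)
    (hGH : ∀ x ∈ G, ∀ y, volume (H ∩ Set.uIcc x y) ≤ ENNReal.ofReal (t * |x - y|))
    {x : ℝ} (hx : x ∉ G) :
    (volume.withDensity ρ).real (H ∩ Gᶜ.ordConnectedComponent x) ≤
      (volume.withDensity ρ).real Set.univ - (volume.withDensity ρ).real Set.univ ^ (1 - t) *
        ((volume.withDensity ρ).real Set.univ -
          (volume.withDensity ρ).real (Gᶜ.ordConnectedComponent x)) ^ t := by
  have := hρ.isFiniteMeasure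
  have hn := nullSingletonClass_withDensity ρ
  set ν := volume.withDensity ρ with hν
  have hright : ∀ α ∈ G, ∀ s, α ≤ s →
      volume (H ∩ Set.Icc α s) ≤ ENNReal.ofReal (t * (s - α)) := fun α hα s hs => by
    have := hGH α hα s
    rwa [Set.uIcc_of_le hs, abs_sub_comm, abs_of_nonneg (by linarith)] at this
  have hleft : ∀ β ∈ G, ∀ s ≤ β,
      volume (H ∩ Set.Icc s β) ≤ ENNReal.ofReal (t * (β - s)) := fun β hβ s hs => by
    have := hGH β hβ s
    rwa [Set.uIcc_of_ge hs, abs_of_nonneg (by linarith)] at this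
  have hcl : (G ∩ Set.Iic x).Nonempty → ∃ α ∈ G, α < x ∧ Set.Ioc α x ⊆ Gᶜ := fun hne => by
    have hb : BddAbove (G ∩ Set.Iic x) := ⟨x, fun y hy => hy.2⟩
    have hmem := (hG.inter isClosed_Iic).csSup_mem hne hb
    refine ⟨_, hmem.1, lt_of_le_of_ne hmem.2 fun h => hx (h ▸ hmem.1), fun y hy hyG => ?_⟩
    exact absurd (le_csSup hb ⟨hyG, hy.2⟩) (not_le.mpr hy.1)
  have hcr : (G ∩ Set.Ici x).Nonempty → ∃ β ∈ G, x < β ∧ Set.Ico x β ⊆ Gᶜ := fun hne => by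
    have hb : BddBelow (G ∩ Set.Ici x) := ⟨x, fun y hy => hy.2⟩
    have hmem := (hG.inter isClosed_Ici).csInf_mem hne hb
    refine ⟨_, hmem.1, lt_of_le_of_ne hmem.2 fun h => hx (h ▸ hmem.1), fun y hy hyG => ?_⟩
    exact absurd (csInf_le hb ⟨hyG, hy.1⟩) (not_le.mpr hy.2)
  have hsubl : ∀ α ∈ G, α < x → Gᶜ.ordConnectedComponent x ⊆ Set.Ioi α := fun α hα hαx y hy => by
    by_contra hya
    exact Set.mem_ordConnectedComponent.mp hy
      (Set.mem_uIcc.mpr (Or.inr ⟨not_lt.mp hya, hαx.le⟩)) hα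
  have hsubr : ∀ β ∈ G, x < β → Gᶜ.ordConnectedComponent x ⊆ Set.Iio β := fun β hβ hxβ y hy => by
    by_contra hyb
    exact Set.mem_ordConnectedComponent.mp hy
      (Set.mem_uIcc.mpr (Or.inl ⟨hxβ.le, not_lt.mp hyb⟩)) hβ
  by_cases hl : (G ∩ Set.Iic x).Nonempty
  · obtain ⟨α, hαG, hαx, hα⟩ := hcl hl
    by_cases hr : (G ∩ Set.Ici x).Nonempty
    · obtain ⟨β, hβG, hxβ, hβ⟩ := hcr hr
      have hU : Gᶜ.ordConnectedComponent x = Set.Ioo α β := by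
        refine Set.Subset.antisymm (fun y hy => ⟨hsubl α hαG hαx hy, hsubr β hβG hxβ hy⟩) ?_
        rintro y ⟨hy1, hy2⟩
        refine Set.mem_ordConnectedComponent.mpr fun w hw => ?_
        rcases Set.mem_uIcc.mp hw with ⟨h1, h2⟩ | ⟨h1, h2⟩
        · exact hβ ⟨h1, h2.trans_lt hy2⟩
        · exact hα ⟨hy1.trans_le h1, h2⟩
      have hmass : ν.real Set.univ - ν.real (Set.Ioo α β) =
          ν.real (Set.Iic α) + ν.real (Set.Ici β) := by
        rw [← measureReal_add_measureReal_compl (μ := ν) (measurableSet_Ioo (a := α) (b := β)),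
          add_sub_cancel_left, ← measureReal_union (μ := ν) ?_ measurableSet_Ici]
        · congr 1
          ext y; simp only [Set.mem_compl_iff, Set.mem_Ioo, Set.mem_union, Set.mem_Iic, Set.mem_Ici]
          grind
        · exact Set.disjoint_left.mpr fun y h1 h2 => by
            simp only [Set.mem_Iic, Set.mem_Ici] at h1 h2; linarith
      rw [hU, hmass]
      exact (measureReal_mono (Set.inter_subset_inter_right _ Set.Ioo_subset_Icc_self)).trans
        (hρ.measureReal_inter_Icc_le ht0 ht1 (hαx.trans hxβ) hHm (hright α hαG) (hleft β hβG))
    · have hU : Gᶜ.ordConnectedComponent x = Set.Ioi α := by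
        refine Set.Subset.antisymm (hsubl α hαG hαx) fun y hy => ?_
        refine Set.mem_ordConnectedComponent.mpr fun w hw hwG => ?_
        rcases Set.mem_uIcc.mp hw with ⟨h1, h2⟩ | ⟨h1, h2⟩
        · exact hr ⟨w, hwG, h1⟩
        · exact hα ⟨lt_of_lt_of_le hy h1, h2⟩ hwG
      have hmass : ν.real Set.univ - ν.real (Set.Ioi α) = ν.real (Set.Iic α) := by
        rw [← measureReal_add_measureReal_compl (μ := ν) (measurableSet_Ioi (a := α)),
          add_sub_cancel_left, Set.compl_Ioi]
      rw [hU, hmass]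
      exact (measureReal_mono (Set.inter_subset_inter_right _ Set.Ioi_subset_Ici_self)).trans
        (hρ.measureReal_inter_Ici_le ht0 ht1 hHm (hright α hαG))
  · have hr : (G ∩ Set.Ici x).Nonempty := by
      obtain ⟨g, hg⟩ := hGne
      refine ⟨g, hg, ?_⟩
      rcases le_total x g with h | h
      · exact h
      · exact absurd ⟨g, hg, h⟩ hl
    obtain ⟨β, hβG, hxβ, hβ⟩ := hcr hr
    have hU : Gᶜ.ordConnectedComponent x = Set.Iio β := by
      refine Set.Subset.antisymm (hsubr β hβG hxβ) fun y hy => ?_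
      refine Set.mem_ordConnectedComponent.mpr fun w hw hwG => ?_
      rcases Set.mem_uIcc.mp hw with ⟨h1, h2⟩ | ⟨h1, h2⟩
      · exact hβ ⟨h1, lt_of_le_of_lt h2 hy⟩ hwG
      · exact hl ⟨w, hwG, h2⟩
    have hmass : ν.real Set.univ - ν.real (Set.Iio β) = ν.real (Set.Ici β) := by
      rw [← measureReal_add_measureReal_compl (μ := ν) (measurableSet_Iio (a := β)),
        add_sub_cancel_left, Set.compl_Iio]
    rw [hU, hmass]
    exact (measureReal_mono (Set.inter_subset_inter_right _ Set.Iio_subset_Iic_self)).trans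
      (hρ.measureReal_inter_Iic_le ht0 ht1 hHm (hleft β hβG))

/-- The dilation inequality on the line: if a closed set `H` occupies at most the fraction `t` of
every segment that starts in `G`, then a log-concave measure of `G` is controlled by that of the
complement of `H`. The estimate is made in every component of the complement of `G`, and the
contributions are added up by superadditivity. -/
theorem measureReal_le_of_sparse (hρ : IsLogConcaveDensity ρ) {t : ℝ} (ht0 : 0 < t) (ht1 : t < 1)
    {G H : Set ℝ} (hG : IsClosed G) (hH : IsClosed H) (hdisj : Disjoint G H)
    (hGH : ∀ x ∈ G, ∀ y, volume (H ∩ Set.uIcc x y) ≤ ENNReal.ofReal (t * |x - y|)) :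
    (volume.withDensity ρ).real Set.univ ^ (1 - t) * (volume.withDensity ρ).real G ^ t ≤
      (volume.withDensity ρ).real Hᶜ := by
  have := hρ.isFiniteMeasure
  have hcomp := fun hGne x hx =>
    hρ.ordConnectedComponent_le (x := x) ht0 ht1 hG hGne hH.measurableSet hGH hx
  obtain ⟨R, hR⟩ := hρ.exists_support
  have hHR : (volume.withDensity ρ).real (H ∩ Set.Icc (-R) R) = (volume.withDensity ρ).real H := by
    have h0 : volume.withDensity ρ (Set.Icc (-R) R)ᶜ = 0 := by
      rw [withDensity_apply _ measurableSet_Icc.compl, setLIntegral_congr_fun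
        (g := fun _ => 0) measurableSet_Icc.compl]
      · simp
      · intro x hx
        refine hR x ?_
        by_contra! hle
        exact hx (abs_le.mp hle)
    refine measureReal_congr ?_
    have h1 : ∀ᵐ x ∂(volume.withDensity ρ), x ∈ Set.Icc (-R) R := by
      rw [ae_iff]; exact h0
    filter_upwards [h1] with x hx
    exact propext ⟨fun h => h.1, fun h => ⟨h, hx⟩⟩
  set ν := volume.withDensity ρ with hν
  set M := ν.real Set.univ with hM
  have hM0 : 0 ≤ M := measureReal_nonneg
  rcases G.eq_empty_or_nonempty with rfl | hGne
  · simp [Real.zero_rpow ht0.ne']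
  have hK : IsCompact (H ∩ Set.Icc (-R) R) := isCompact_Icc.inter_left hH
  have hHG : ∀ x ∈ H, x ∉ G := fun x hxH hxG => Set.disjoint_left.mp hdisj hxG hxH
  obtain ⟨s, hsK, hs⟩ := hK.elim_nhds_subcover (fun x => Gᶜ.ordConnectedComponent x) fun x hx =>
    Set.ordConnectedComponent_mem_nhds.mpr (hG.isOpen_compl.mem_nhds (hHG x hx.1))
  classical
  set S := s.image fun x => Gᶜ.ordConnectedComponent x with hS
  have hSform : ∀ U ∈ S, ∃ x ∉ G, U = Gᶜ.ordConnectedComponent x := fun U hU => by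
    obtain ⟨x, hx, rfl⟩ := Finset.mem_image.mp hU
    exact ⟨x, hHG x (hsK x hx).1, rfl⟩
  have hcover : H ∩ Set.Icc (-R) R ⊆ ⋃ U ∈ S, H ∩ U := by
    intro x hx
    obtain ⟨y, hy, hxy⟩ := Set.mem_iUnion₂.mp (hs hx)
    exact Set.mem_iUnion₂.mpr ⟨_, Finset.mem_image_of_mem _ hy, hx.1, hxy⟩
  have hpd : (S : Set (Set ℝ)).PairwiseDisjoint id := by
    intro U hU V hV hUV
    obtain ⟨x, -, rfl⟩ := hSform U hU
    obtain ⟨y, -, rfl⟩ := hSform V hV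
    refine Set.disjoint_left.mpr fun z hzx hzy => hUV ?_
    exact (Set.ordConnectedComponent_eq (Set.mem_ordConnectedComponent.mp hzx)).trans
      (Set.ordConnectedComponent_eq (Set.mem_ordConnectedComponent.mp hzy)).symm
  have hmeas : ∀ U ∈ S, MeasurableSet U := fun U hU => by
    obtain ⟨x, -, rfl⟩ := hSform U hU
    exact Set.OrdConnected.measurableSet inferInstance
  have hsum : ∑ U ∈ S, ν.real U ≤ M - ν.real G := by
    have h1 := measureReal_biUnion_finset (μ := ν) hpd hmeas
    simp only [id] at h1
    rw [← h1, hM, ← measureReal_add_measureReal_compl (μ := ν) hG.measurableSet,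
      add_sub_cancel_left]
    refine measureReal_mono (Set.iUnion₂_subset fun U hU => ?_)
    obtain ⟨x, -, rfl⟩ := hSform U hU
    exact Set.ordConnectedComponent_subset
  have hG0 : 0 ≤ ν.real G := measureReal_nonneg
  have hHle : ν.real H ≤ M - M ^ (1 - t) * ν.real G ^ t := by
    calc ν.real H = ν.real (H ∩ Set.Icc (-R) R) := hHR.symm
      _ ≤ ∑ U ∈ S, ν.real (H ∩ U) :=
          (measureReal_mono hcover (measure_ne_top _ _)).trans (measureReal_biUnion_finset_le _ _)
      _ ≤ ∑ U ∈ S, (M - M ^ (1 - t) * (M - ν.real U) ^ t) := by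
          refine Finset.sum_le_sum fun U hU => ?_
          obtain ⟨x, hx, rfl⟩ := hSform U hU
          exact hcomp hGne x hx
      _ ≤ M - M ^ (1 - t) * (M - ∑ U ∈ S, ν.real U) ^ t :=
          sum_sub_rpow_mul_rpow_le S (fun U => measureReal_nonneg) hM0 ht0 ht1 (by linarith)
      _ ≤ M - M ^ (1 - t) * ν.real G ^ t := by
          gcongr
          linarith
  have := measureReal_add_measureReal_compl (μ := ν) hH.measurableSet
  linarith

end IsLogConcaveDensity

/-! ### Needle decomposition by bisection -/

/-- The closed half-space of points `x` with `a (x i - p) + b (x j - q) ≥ 0`; its boundary contains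
the flat `x i = p`, `x j = q`. -/
def coordHalfSpace {n : ℕ} (i j : Fin n) (p q a b : ℝ) : Set (Fin n → ℝ) :=
  {x | 0 ≤ a * (x i - p) + b * (x j - q)}

theorem isClosed_coordHalfSpace {n : ℕ} (i j : Fin n) (p q a b : ℝ) :
    IsClosed (coordHalfSpace i j p q a b) :=
  isClosed_le continuous_const (by fun_prop)

theorem convex_coordHalfSpace {n : ℕ} (i j : Fin n) (p q a b : ℝ) :
    Convex ℝ (coordHalfSpace i j p q a b) := by
  intro x hx y hy s t hs ht hst
  simp only [coordHalfSpace, Set.mem_ofPred_eq, Pi.add_apply, Pi.smul_apply, smul_eq_mul] at *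
  have h : a * (s * x i + t * y i - p) + b * (s * x j + t * y j - q) =
      s * (a * (x i - p) + b * (x j - q)) + t * (a * (y i - p) + b * (y j - q)) := by
    linear_combination (a * p + b * q) * hst
  rw [h]
  positivity

theorem volume_boundary_coordHalfSpace {n : ℕ} {i j : Fin n} (hij : i ≠ j) (p q : ℝ) {a b : ℝ}
    (hab : a ≠ 0 ∨ b ≠ 0) :
    volume {x : Fin n → ℝ | a * (x i - p) + b * (x j - q) = 0} = 0 := by
  set l : (Fin n → ℝ) →ₗ[ℝ] ℝ := a • LinearMap.proj i + b • LinearMap.proj j with hl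
  have hker : LinearMap.ker l ≠ ⊤ := by
    intro htop
    rw [LinearMap.ker_eq_top] at htop
    have hi := LinearMap.congr_fun htop (Pi.single i 1)
    have hj := LinearMap.congr_fun htop (Pi.single j 1)
    simp [hl, hij, hij.symm] at hi hj
    tauto
  set x₀ : Fin n → ℝ := Function.update (fun _ => q) i p with hx₀
  have hset : {x : Fin n → ℝ | a * (x i - p) + b * (x j - q) = 0} =
      (fun x => x - x₀) ⁻¹' (LinearMap.ker l : Set (Fin n → ℝ)) := by
    ext x
    simp [hl, hx₀, hij.symm]
  simp_rw [hset, sub_eq_add_neg]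
  rw [measure_preimage_add_right]
  exact Measure.addHaar_submodule _ _ hker

theorem cos_ne_zero_or_sin_ne_zero (θ : ℝ) : Real.cos θ ≠ 0 ∨ Real.sin θ ≠ 0 := by
  by_contra! h
  have := Real.sin_sq_add_cos_sq θ
  simp [h.1, h.2] at this

theorem continuous_measureReal_inter_coordHalfSpace {n : ℕ} {i j : Fin n} (hij : i ≠ j) (p q : ℝ)
    {S : Set (Fin n → ℝ)} (hS : volume S ≠ ⊤) :
    Continuous fun θ : ℝ =>
      volume.real (S ∩ coordHalfSpace i j p q (Real.cos θ) (Real.sin θ)) := by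
  have hm : ∀ θ : ℝ, MeasurableSet (coordHalfSpace i j p q (Real.cos θ) (Real.sin θ)) :=
    fun θ => (isClosed_coordHalfSpace ..).measurableSet
  have hfin : IsFiniteMeasure (volume.restrict S) := ⟨by simpa using hS.lt_top⟩
  have heq : ∀ θ : ℝ, volume.real (S ∩ coordHalfSpace i j p q (Real.cos θ) (Real.sin θ)) =
      (volume.restrict S (coordHalfSpace i j p q (Real.cos θ) (Real.sin θ))).toReal := fun θ => by
    rw [Measure.restrict_apply (hm θ), Set.inter_comm, measureReal_def]
  simp_rw [heq]
  refine continuous_iff_continuousAt.mpr fun θ => ?_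
  refine (ENNReal.continuousAt_toReal (measure_ne_top _ _)).tendsto.comp
    (tendsto_measure_of_ae_tendsto_indicator_of_isFiniteMeasure (𝓝 θ) (hm θ) hm ?_)
  have hne : ∀ᵐ x ∂(volume.restrict S),
      Real.cos θ * (x i - p) + Real.sin θ * (x j - q) ≠ 0 := by
    refine ae_restrict_of_ae ?_
    rw [ae_iff]
    simpa using volume_boundary_coordHalfSpace hij p q (cos_ne_zero_or_sin_ne_zero θ)
  filter_upwards [hne] with x hx
  have hc : Continuous fun θ : ℝ => Real.cos θ * (x i - p) + Real.sin θ * (x j - q) := by fun_prop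
  simp only [coordHalfSpace, Set.mem_ofPred_eq]
  rcases lt_or_gt_of_ne hx with h | h
  · filter_upwards [hc.tendsto θ (gt_mem_nhds h)] with w hw
    exact ⟨fun hle => absurd hle (not_le.mpr hw), fun hle => absurd hle (not_le.mpr h)⟩
  · filter_upwards [hc.tendsto θ (lt_mem_nhds h)] with w hw
    exact ⟨fun _ => h.le, fun _ => le_of_lt hw⟩

theorem measureReal_inter_coordHalfSpace_add {n : ℕ} {i j : Fin n} (hij : i ≠ j) (p q : ℝ) {a b : ℝ}
    (hab : a ≠ 0 ∨ b ≠ 0) {S : Set (Fin n → ℝ)} (hS : volume S ≠ ⊤) :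
    volume.real (S ∩ coordHalfSpace i j p q a b) +
      volume.real (S ∩ coordHalfSpace i j p q (-a) (-b)) = volume.real S := by
  rw [← measureReal_inter_add_sdiff (s := S) (t := coordHalfSpace i j p q a b)
    (isClosed_coordHalfSpace ..).measurableSet hS]
  congr 1
  refine measureReal_congr ?_
  have hne : ∀ᵐ x : Fin n → ℝ, a * (x i - p) + b * (x j - q) ≠ 0 := by
    rw [ae_iff]
    simpa using volume_boundary_coordHalfSpace hij p q hab
  filter_upwards [hne] with x hx
  refine propext (and_congr_right fun _ => ?_)
  change 0 ≤ -a * (x i - p) + -b * (x j - q) ↔ ¬ 0 ≤ a * (x i - p) + b * (x j - q)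
  rw [not_le, show -a * (x i - p) + -b * (x j - q) = -(a * (x i - p) + b * (x j - q)) by ring,
    Left.nonneg_neg_iff]
  exact ⟨fun h => lt_of_le_of_ne h hx, le_of_lt⟩

/-- The invariant of the bisection procedure: a convex body `K` inside `F` that `E` meets in the
fraction `e` exactly, and that `G` meets in a fraction larger than `γ`. -/
structure IsBisectionBody {n : ℕ} (F E G : Set (Fin n → ℝ)) (e γ : ℝ) (K : Set (Fin n → ℝ)) :
    Prop where
  isCompact : IsCompact K
  convex : Convex ℝ K
  subset : K ⊆ F
  measureReal_eq : volume.real (E ∩ K) = e * volume.real K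
  lt_measureReal : γ * volume.real K < volume.real (G ∩ K)

namespace IsBisectionBody

variable {n : ℕ} {F E G K : Set (Fin n → ℝ)} {e γ : ℝ}

/-- Among the hyperplanes through a flat of codimension two, one divides `E ∩ K` and `K` in the
same proportion, by the intermediate value theorem; keep the half that is richer in `G`. -/
theorem exists_half (hK : IsBisectionBody F E G e γ K) {i j : Fin n} (hij : i ≠ j) (p q : ℝ) :
    ∃ a b : ℝ, (a ≠ 0 ∨ b ≠ 0) ∧
      IsBisectionBody F E G e γ (K ∩ coordHalfSpace i j p q a b) := by
  have hKfin : ∀ S : Set (Fin n → ℝ), volume (S ∩ K) ≠ ⊤ := fun S =>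
    measure_ne_top_of_subset Set.inter_subset_right hK.isCompact.measure_lt_top.ne
  have hKfin' : volume K ≠ ⊤ := hK.isCompact.measure_lt_top.ne
  set f : ℝ → ℝ := fun θ =>
    volume.real (E ∩ K ∩ coordHalfSpace i j p q (Real.cos θ) (Real.sin θ)) -
      e * volume.real (K ∩ coordHalfSpace i j p q (Real.cos θ) (Real.sin θ)) with hf
  have hfc : Continuous f :=
    (continuous_measureReal_inter_coordHalfSpace hij p q (hKfin E)).sub
      ((continuous_measureReal_inter_coordHalfSpace hij p q hKfin').const_mul e)
  have hadd : ∀ {a b : ℝ}, (a ≠ 0 ∨ b ≠ 0) → ∀ {S : Set (Fin n → ℝ)}, volume S ≠ ⊤ →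
      volume.real (S ∩ coordHalfSpace i j p q a b) +
        volume.real (S ∩ coordHalfSpace i j p q (-a) (-b)) = volume.real S :=
    fun hab _ hS => measureReal_inter_coordHalfSpace_add hij p q hab hS
  have hfπ : f Real.pi = - f 0 := by
    have h1 := hadd (cos_ne_zero_or_sin_ne_zero 0) (hKfin E)
    have h2 := hadd (cos_ne_zero_or_sin_ne_zero 0) hKfin'
    simp only [hf, Real.cos_pi, Real.sin_pi, Real.cos_zero, Real.sin_zero, neg_zero] at h1 h2 ⊢
    have h3 := hK.measureReal_eq
    rw [← h1, ← h2] at h3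
    linarith
  obtain ⟨θ, hθ⟩ : ∃ θ, f θ = 0 := by
    have hrange := mem_range_of_exists_le_of_exists_ge (f := f) (c := 0) hfc
    rcases le_total (f 0) 0 with h | h
    · exact hrange ⟨0, h⟩ ⟨Real.pi, by rw [hfπ]; linarith⟩
    · exact hrange ⟨Real.pi, by rw [hfπ]; linarith⟩ ⟨0, h⟩
  have hab := cos_ne_zero_or_sin_ne_zero θ
  simp only [hf] at hθ
  generalize Real.cos θ = a at *
  generalize Real.sin θ = b at *
  have hE := hadd hab (hKfin E)
  have hG := hadd hab (hKfin G)
  have hKK := hadd hab hKfin'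
  have hlt := hK.lt_measureReal
  have heq := hK.measureReal_eq
  rw [← hG, ← hKK] at hlt
  rw [← hE, ← hKK] at heq
  by_cases hcase : γ * volume.real (K ∩ coordHalfSpace i j p q a b) <
      volume.real (G ∩ K ∩ coordHalfSpace i j p q a b)
  · refine ⟨a, b, hab, ⟨hK.isCompact.inter_right (isClosed_coordHalfSpace ..),
      hK.convex.inter (convex_coordHalfSpace ..), Set.inter_subset_left.trans hK.subset, ?_, ?_⟩⟩
    · rw [← Set.inter_assoc]; linarith
    · rwa [← Set.inter_assoc]
  · refine ⟨-a, -b, by simpa using hab, ⟨hK.isCompact.inter_right (isClosed_coordHalfSpace ..),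
      hK.convex.inter (convex_coordHalfSpace ..), Set.inter_subset_left.trans hK.subset, ?_, ?_⟩⟩
    · rw [← Set.inter_assoc]; linarith
    · rw [← Set.inter_assoc]; linarith

theorem nonempty (hK : IsBisectionBody F E G e γ K) : K.Nonempty := by
  rw [Set.nonempty_iff_ne_empty]
  rintro rfl
  simpa using hK.lt_measureReal

/-- Cutting through all flats `x i = p`, `x j = q` with rational `p` and `q`, one after another. -/
theorem exists_sequence (hK : IsBisectionBody F E G e γ K) :
    ∃ k : ℕ → Set (Fin n → ℝ), Antitone k ∧ (∀ m, IsBisectionBody F E G e γ (k m)) ∧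
      ∀ i j : Fin n, i ≠ j → ∀ p q : ℚ, ∃ m, ∃ a b : ℝ, (a ≠ 0 ∨ b ≠ 0) ∧
        k m ⊆ coordHalfSpace i j p q a b := by
  rcases isEmpty_or_nonempty (Fin n) with hn | hn
  · exact ⟨fun _ => K, antitone_const, fun _ => hK, fun i => (hn.false i).elim⟩
  obtain ⟨c, hc⟩ := exists_surjective_nat (Fin n × Fin n × ℚ × ℚ)
  have hstep : ∀ (m : ℕ) (L : {L // IsBisectionBody F E G e γ L}),
      ∃ L' : {L // IsBisectionBody F E G e γ L}, L'.1 ⊆ L.1 ∧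
        ((c m).1 ≠ (c m).2.1 → ∃ a b : ℝ, (a ≠ 0 ∨ b ≠ 0) ∧
          L'.1 ⊆ coordHalfSpace (c m).1 (c m).2.1 (c m).2.2.1 (c m).2.2.2 a b) := by
    intro m L
    by_cases hij : (c m).1 ≠ (c m).2.1
    · obtain ⟨a, b, hab, hL⟩ := L.2.exists_half hij (c m).2.2.1 (c m).2.2.2
      exact ⟨⟨_, hL⟩, Set.inter_subset_left, fun _ => ⟨a, b, hab, Set.inter_subset_right⟩⟩
    · exact ⟨L, subset_rfl, fun h => absurd h hij⟩
  choose next hnext hcut using hstep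
  set k : ℕ → {L // IsBisectionBody F E G e γ L} := fun m => Nat.rec ⟨K, hK⟩ next m with hk
  refine ⟨fun m => (k m).1, antitone_nat_of_succ_le fun m => hnext m (k m), fun m => (k m).2,
    fun i j hij p q => ?_⟩
  obtain ⟨m, hm⟩ := hc (i, j, p, q)
  have := hcut m (k m)
  rw [hm] at this
  exact ⟨m + 1, this hij⟩

end IsBisectionBody

/-- A triangle whose projection to the coordinates `i`, `j` is nondegenerate contains, strictly
inside, a point for which both coordinates are rational. -/
theorem exists_rat_mem_triangle {u₁ u₂ v₁ v₂ : ℝ} (hdet : u₁ * v₂ - u₂ * v₁ ≠ 0) (x₁ x₂ : ℝ) :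
    ∃ (p q : ℚ) (s t : ℝ), 0 < s ∧ 0 < t ∧ s + t < 1 ∧
      x₁ + s * u₁ + t * v₁ = p ∧ x₂ + s * u₂ + t * v₂ = q := by
  set D := u₁ * v₂ - u₂ * v₁ with hD
  -- Barycentric coordinates by Cramer's rule; they vary continuously.
  set S : ℝ × ℝ → ℝ := fun z => ((z.1 - x₁) * v₂ - (z.2 - x₂) * v₁) / D with hS
  set T : ℝ × ℝ → ℝ := fun z => (u₁ * (z.2 - x₂) - u₂ * (z.1 - x₁)) / D with hT
  have hSc : Continuous S := by fun_prop
  have hTc : Continuous T := by fun_prop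
  have hopen : IsOpen {z | 0 < S z ∧ 0 < T z ∧ S z + T z < 1} :=
    (isOpen_lt continuous_const hSc).inter
      ((isOpen_lt continuous_const hTc).inter (isOpen_lt (hSc.add hTc) continuous_const))
  have hne : {z | 0 < S z ∧ 0 < T z ∧ S z + T z < 1}.Nonempty := by
    refine ⟨(x₁ + u₁ / 3 + v₁ / 3, x₂ + u₂ / 3 + v₂ / 3), ?_⟩
    have h1 : S (x₁ + u₁ / 3 + v₁ / 3, x₂ + u₂ / 3 + v₂ / 3) = 1 / 3 := by
      simp only [hS]; rw [div_eq_iff hdet, hD]; ring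
    have h2 : T (x₁ + u₁ / 3 + v₁ / 3, x₂ + u₂ / 3 + v₂ / 3) = 1 / 3 := by
      simp only [hT]; rw [div_eq_iff hdet, hD]; ring
    change 0 < S _ ∧ 0 < T _ ∧ S _ + T _ < 1
    rw [h1, h2]; norm_num
  have hdense : DenseRange (Prod.map ((↑) : ℚ → ℝ) ((↑) : ℚ → ℝ)) :=
    Rat.denseRange_cast.prodMap Rat.denseRange_cast
  obtain ⟨⟨p, q⟩, h1, h2, h3⟩ := hdense.exists_mem_open hopen hne
  refine ⟨p, q, S (p, q), T (p, q), h1, h2, h3, ?_, ?_⟩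
  · simp only [hS, hT]; field_simp; rw [hD]; ring
  · simp only [hS, hT]; field_simp; rw [hD]; ring

/-- A set that lies on one side of some hyperplane through each flat `x i = p`, `x j = q` with
rational `p` and `q` contains no nondegenerate triangle. -/
theorem minor_eq_zero_of_coordHalfSpace {n : ℕ} {C : Set (Fin n → ℝ)} {i j : Fin n}
    (hC : ∀ p q : ℚ, ∃ a b : ℝ, (a ≠ 0 ∨ b ≠ 0) ∧ C ⊆ coordHalfSpace i j p q a b)
    {x y z : Fin n → ℝ} (hx : x ∈ C) (hy : y ∈ C) (hz : z ∈ C) :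
    (y i - x i) * (z j - x j) - (y j - x j) * (z i - x i) = 0 := by
  by_contra hdet
  obtain ⟨p, q, s, t, hs, ht, hst, hp, hq⟩ := exists_rat_mem_triangle hdet (x i) (x j)
  obtain ⟨a, b, hab, hCsub⟩ := hC p q
  have hx' := hCsub hx
  have hy' := hCsub hy
  have hz' := hCsub hz
  simp only [coordHalfSpace, Set.mem_ofPred_eq] at hx' hy' hz'
  set X := a * (x i - p) + b * (x j - q) with hX
  set Y := a * (y i - p) + b * (y j - q) with hY
  set Z := a * (z i - p) + b * (z j - q) with hZ
  have hzero : (1 - s - t) * X + s * Y + t * Z = 0 := by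
    rw [hX, hY, hZ]
    linear_combination a * hp + b * hq
  have hX0 : X = 0 := by nlinarith [mul_nonneg hs.le hy', mul_nonneg ht.le hz']
  have hY0 : Y = 0 := by nlinarith [mul_nonneg ht.le hz']
  have hZ0 : Z = 0 := by nlinarith
  have h1 : a * (y i - x i) + b * (y j - x j) = 0 := by linarith
  have h2 : a * (z i - x i) + b * (z j - x j) = 0 := by linarith
  have ha : a * ((y i - x i) * (z j - x j) - (y j - x j) * (z i - x i)) = 0 := by
    linear_combination (z j - x j) * h1 - (y j - x j) * h2
  have hb : b * ((y i - x i) * (z j - x j) - (y j - x j) * (z i - x i)) = 0 := by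
    linear_combination (y i - x i) * h2 - (z i - x i) * h1
  rcases hab with h | h
  · exact (mul_ne_zero h hdet) ha
  · exact (mul_ne_zero h hdet) hb

theorem exists_line_of_minor_eq_zero {n : ℕ} (hn : 0 < n) {C : Set (Fin n → ℝ)} (hC : C.Nonempty)
    (hminor : ∀ i j : Fin n, i ≠ j → ∀ x ∈ C, ∀ y ∈ C, ∀ z ∈ C,
      (y i - x i) * (z j - x j) - (y j - x j) * (z i - x i) = 0) :
    ∃ (i : Fin n) (v w : Fin n → ℝ), ∀ z ∈ C, z = v + z i • w := by
  obtain ⟨x, hx⟩ := hC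
  by_cases hsub : ∀ y ∈ C, y = x
  · exact ⟨⟨0, hn⟩, x, 0, fun z hz => by simp [hsub z hz]⟩
  · push Not at hsub
    obtain ⟨y, hy, hyx⟩ := hsub
    obtain ⟨i, hi⟩ := Function.ne_iff.mp hyx
    have hi' : y i - x i ≠ 0 := sub_ne_zero.mpr hi
    refine ⟨i, x - (x i / (y i - x i)) • (y - x), (1 / (y i - x i)) • (y - x), fun z hz => ?_⟩
    ext j
    simp only [Pi.add_apply, Pi.sub_apply, Pi.smul_apply, smul_eq_mul]
    rcases eq_or_ne i j with rfl | hij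
    · field_simp; ring
    · have := hminor i j hij x hx y hy z hz
      field_simp
      linear_combination this

/-- Bisection produces a body of the same kind on which a given continuous function is almost
constant across the direction of a line. -/
theorem IsBisectionBody.exists_thin {n : ℕ} (hn : 0 < n) {F E G K : Set (Fin n → ℝ)} {e γ : ℝ}
    (hK : IsBisectionBody F E G e γ K) {f : (Fin n → ℝ) → ℝ} (hf : Continuous f) {ε : ℝ}
    (hε : 0 < ε) :
    ∃ (L : Set (Fin n → ℝ)) (i : Fin n) (v w : Fin n → ℝ), IsBisectionBody F E G e γ L ∧
      ∀ x ∈ L, |f x - f (v + x i • w)| < ε := by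
  obtain ⟨k, hanti, hk, hcut⟩ := hK.exists_sequence
  have hdir : Directed (fun x1 x2 => x1 ⊇ x2) k := hanti.directed_ge
  have hne : (⋂ m, k m).Nonempty :=
    IsCompact.nonempty_iInter_of_directed_nonempty_isCompact_isClosed k hdir
      (fun m => (hk m).nonempty) (fun m => (hk m).isCompact) (fun m => (hk m).isCompact.isClosed)
  obtain ⟨i, v, w, hline⟩ := exists_line_of_minor_eq_zero hn hne fun i j hij x hx y hy z hz =>
    minor_eq_zero_of_coordHalfSpace (fun p q => by
      obtain ⟨m, a, b, hab, hsub⟩ := hcut i j hij p q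
      exact ⟨a, b, hab, (Set.iInter_subset k m).trans hsub⟩) hx hy hz
  have hopen : IsOpen {x : Fin n → ℝ | |f x - f (v + x i • w)| < ε} :=
    isOpen_lt (by fun_prop) continuous_const
  obtain ⟨m, hm⟩ := exists_subset_nhds_of_isCompact (V := k) hdir (fun m => (hk m).isCompact)
    (U := {x : Fin n → ℝ | |f x - f (v + x i • w)| < ε}) fun x hx => hopen.mem_nhds (by
      change |f x - f (v + x i • w)| < ε
      rw [← hline x hx]; simpa using hε)
  exact ⟨k m, i, v, w, hk m, fun x hx => hm hx⟩

/-! ### Marginals of convex bodies -/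

/-- The marginal of a set on the `i`-th coordinate: the volume of its slices. -/
noncomputable def marginal {n : ℕ} (i : Fin (n + 1)) (K : Set (Fin (n + 1) → ℝ)) (s : ℝ) : ℝ≥0∞ :=
  volume {y : Fin n → ℝ | (i.insertNth s y : Fin (n + 1) → ℝ) ∈ K}

theorem measurable_marginal {n : ℕ} (i : Fin (n + 1)) {K : Set (Fin (n + 1) → ℝ)}
    (hK : MeasurableSet K) : Measurable (marginal i K) :=
  measurable_measure_prodMk_left (ν := (volume : Measure (Fin n → ℝ))) (measurable_insertNth i hK)

theorem withDensity_marginal {n : ℕ} (i : Fin (n + 1)) {K : Set (Fin (n + 1) → ℝ)}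
    (hK : MeasurableSet K) {T : Set ℝ} (hT : MeasurableSet T) :
    volume.withDensity (marginal i K) T = volume (K ∩ {x | x i ∈ T}) := by
  have hm : MeasurableSet (K ∩ {x | x i ∈ T}) := hK.inter (measurable_pi_apply i hT)
  rw [withDensity_apply _ hT, ← lintegral_indicator hT, ← lintegral_indicator_one hm,
    lintegral_eq_lintegral_lintegral_insertNth i (measurable_one.indicator hm)]
  refine lintegral_congr fun s => ?_
  by_cases hs : s ∈ T
  · rw [Set.indicator_of_mem hs, marginal, ← lintegral_indicator_one]
    · refine lintegral_congr fun y => ?_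
      by_cases hy : (i.insertNth s y : Fin (n + 1) → ℝ) ∈ K
      · have hy' : (i.insertNth s y : Fin (n + 1) → ℝ) ∈ K ∩ {x | x i ∈ T} :=
          ⟨hy, by simpa using hs⟩
        rw [Set.indicator_of_mem hy', Set.indicator_of_mem (by exact hy)]
        rfl
      · have hy' : (i.insertNth s y : Fin (n + 1) → ℝ) ∉ K ∩ {x | x i ∈ T} := fun h => hy h.1
        rw [Set.indicator_of_notMem hy', Set.indicator_of_notMem (by exact hy)]
    · exact (measurable_insertNth i).comp measurable_prodMk_left hK
  · rw [Set.indicator_of_notMem hs]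
    symm
    rw [lintegral_eq_zero_iff']
    · refine Filter.Eventually.of_forall fun y => ?_
      simp [hs]
    · exact ((measurable_one.indicator hm).comp
        ((measurable_insertNth i).comp measurable_prodMk_left)).aemeasurable

theorem withDensity_marginal_real {n : ℕ} (i : Fin (n + 1)) {K : Set (Fin (n + 1) → ℝ)}
    (hK : MeasurableSet K) {T : Set ℝ} (hT : MeasurableSet T) :
    (volume.withDensity (marginal i K)).real T = volume.real (K ∩ {x | x i ∈ T}) := by
  rw [measureReal_def, withDensity_marginal i hK hT, measureReal_def]

/-- By the Prékopa–Leindler inequality, the marginal of a convex body is log-concave. -/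
theorem isLogConcaveDensity_marginal {n : ℕ} (i : Fin (n + 1)) {K : Set (Fin (n + 1) → ℝ)}
    (hKc : IsCompact K) (hKconv : Convex ℝ K) : IsLogConcaveDensity (marginal i K) where
  measurable := measurable_marginal i hKc.measurableSet
  lintegral_ne_top := by
    have h := withDensity_marginal i hKc.measurableSet MeasurableSet.univ
    rw [withDensity_apply _ MeasurableSet.univ, Measure.restrict_univ] at h
    rw [h]
    exact measure_ne_top_of_subset Set.inter_subset_left hKc.measure_lt_top.ne
  exists_support := by
    obtain ⟨R, hR⟩ := hKc.isBounded.exists_norm_le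
    refine ⟨R, fun s hs => ?_⟩
    have : {y : Fin n → ℝ | (i.insertNth s y : Fin (n + 1) → ℝ) ∈ K} = ∅ := by
      rw [Set.eq_empty_iff_forall_notMem]
      intro y hy
      have h1 := norm_le_pi_norm (i.insertNth s y : Fin (n + 1) → ℝ) i
      rw [Fin.insertNth_apply_same, Real.norm_eq_abs] at h1
      linarith [hR _ hy]
    rw [marginal, this, measure_empty]
  rpow_mul_rpow_le := fun t ht0 ht1 s s' => by
    have hmeas : ∀ s : ℝ, MeasurableSet {y : Fin n → ℝ | (i.insertNth s y : Fin (n + 1) → ℝ) ∈ K} :=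
      fun s => (measurable_insertNth i).comp measurable_prodMk_left hKc.measurableSet
    have key := prekopa_leindler ht0 ht1 (measurable_one.indicator (hmeas s))
      (measurable_one.indicator (hmeas s'))
      (measurable_one.indicator (hmeas ((1 - t) * s + t * s'))) fun y y' => ?_
    · rwa [lintegral_indicator_one (hmeas _), lintegral_indicator_one (hmeas _),
        lintegral_indicator_one (hmeas _)] at key
    · by_cases hy : y ∈ {y : Fin n → ℝ | (i.insertNth s y : Fin (n + 1) → ℝ) ∈ K}
      · by_cases hy' : y' ∈ {y : Fin n → ℝ | (i.insertNth s' y : Fin (n + 1) → ℝ) ∈ K}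
        · have hmem : (1 - t) • y + t • y' ∈ {y : Fin n → ℝ |
              (i.insertNth ((1 - t) * s + t * s') y : Fin (n + 1) → ℝ) ∈ K} := by
            change i.insertNth _ _ ∈ K
            rw [← insertNth_convex_combination]
            exact hKconv hy hy' (by linarith) ht0.le (by ring)
          rw [Set.indicator_of_mem hmem]
          simp [Set.indicator_of_mem hy, Set.indicator_of_mem hy']
        · rw [Set.indicator_of_notMem hy', ENNReal.zero_rpow_of_pos ht0, mul_zero]
          exact zero_le
      · rw [Set.indicator_of_notMem hy, ENNReal.zero_rpow_of_pos (by linarith), zero_mul]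
        exact zero_le

/-! ### Sublevel sets of polynomials on segments -/

theorem one_le_of_isRemezConstant {A : ℝ} (hA : IsRemezConstant A) : 1 ≤ A := by
  have h := hA.2 1 Polynomial.X Polynomial.natDegree_X_le 0 1 one_pos (Set.Icc 0 1) measurableSet_Icc
    subset_rfl (by simp) 1 (by simp)
  have hs : sSup ((fun y : ℝ => |Polynomial.eval y (Polynomial.X : Polynomial ℝ)|) '' Set.Icc 0 1)
      ≤ 1 := by
    refine csSup_le (by simp) ?_
    rintro _ ⟨y, ⟨hy0, hy1⟩, rfl⟩
    simpa [abs_of_nonneg hy0] using hy1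
  have hA0 := hA.1
  simp only [Polynomial.eval_X, abs_one, Real.volume_real_Icc, sub_zero, mul_one, pow_one] at h hs
  norm_num at h
  nlinarith

/-- The real part of a polynomial on the real line is a real polynomial. -/
theorem exists_real_polynomial {𝕜 : Type*} [RCLike 𝕜] {d : ℕ} {p : Polynomial 𝕜}
    (hp : p.natDegree ≤ d) :
    ∃ r : Polynomial ℝ, r.natDegree ≤ d ∧ ∀ s : ℝ, r.eval s = RCLike.re (p.eval (s : 𝕜)) := by
  refine ⟨∑ k ∈ Finset.range (d + 1), Polynomial.monomial k (RCLike.re (p.coeff k)),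
    Polynomial.natDegree_sum_le_of_forall_le _ _ fun k hk =>
      (Polynomial.natDegree_monomial_le _).trans (Nat.lt_succ_iff.mp (Finset.mem_range.mp hk)),
    fun s => ?_⟩
  rw [Polynomial.eval_finsetSum, Polynomial.eval_eq_sum_range' (Nat.lt_succ_of_le hp), map_sum]
  refine Finset.sum_congr rfl fun k _ => ?_
  rw [Polynomial.eval_monomial, ← RCLike.ofReal_pow, RCLike.re_mul_ofReal]

/-- A Remez inequality says that on a segment starting at a point where the polynomial is large, the
sublevel set occupies only a small fraction. The complex case reduces to the real one by a
rotation that makes the value at the starting point real. -/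
theorem volume_sublevel_inter_uIcc_le {𝕜 : Type*} [RCLike 𝕜] {A : ℝ} (hA : IsRemezConstant A)
    {d : ℕ} (hd : d ≠ 0) {p : Polynomial 𝕜} (hp : p.natDegree ≤ d) {c lam : ℝ} (hc : 0 < c)
    (hlam : 0 < lam) {x : ℝ} (hx : (A * lam) ^ d * c ≤ ‖p.eval (x : 𝕜)‖) (y : ℝ) :
    volume ({s : ℝ | ‖p.eval (s : 𝕜)‖ ≤ c} ∩ Set.uIcc x y) ≤ ENNReal.ofReal (lam⁻¹ * |x - y|) := by
  rcases eq_or_ne x y with rfl | hxy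
  · exact (measure_mono Set.inter_subset_right).trans (by simp)
  have hA0 := hA.1
  set Z := {s : ℝ | ‖p.eval (s : 𝕜)‖ ≤ c} ∩ Set.uIcc x y with hZ
  have hcont : Continuous fun s : ℝ => ‖p.eval (s : 𝕜)‖ :=
    (p.continuous.comp RCLike.continuous_ofReal).norm
  have hZm : MeasurableSet Z :=
    (isClosed_le hcont continuous_const).measurableSet.inter measurableSet_uIcc
  rcases eq_or_ne (volume Z) 0 with hZ0 | hZ0
  · rw [hZ0]; exact zero_le
  have hZfin : volume Z ≠ ⊤ :=
    measure_ne_top_of_subset Set.inter_subset_right isCompact_uIcc.measure_lt_top.ne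
  obtain ⟨u, hu, hux⟩ := RCLike.exists_norm_eq_mul_self (p.eval (x : 𝕜))
  obtain ⟨r, hr, hre⟩ := exists_real_polynomial (p := Polynomial.C u * p)
    ((Polynomial.natDegree_C_mul_le u p).trans hp)
  have hrx : |r.eval x| = ‖p.eval (x : 𝕜)‖ := by
    rw [hre, Polynomial.eval_mul, Polynomial.eval_C, ← hux, RCLike.ofReal_re, abs_norm]
  have hrZ : ∀ s ∈ Z, |r.eval s| ≤ c := fun s hs => by
    rw [hre, Polynomial.eval_mul, Polynomial.eval_C]
    refine (RCLike.abs_re_le_norm _).trans ?_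
    rw [norm_mul, hu, one_mul]
    exact hs.1
  have hlt : min x y < max x y := min_lt_max.mpr hxy
  have hlen : max x y - min x y = |x - y| := max_sub_min_eq_abs' x y
  have h := hA.2 d r hr (min x y) (max x y) hlt Z hZm Set.inter_subset_right
    (pos_iff_ne_zero.mpr hZ0) x ⟨min_le_left _ _, le_max_left _ _⟩
  have hsup : sSup ((fun y : ℝ => |r.eval y|) '' Z) ≤ c := by
    refine csSup_le ((nonempty_of_measure_ne_zero hZ0).image _) ?_
    rintro _ ⟨s, hs, rfl⟩
    exact hrZ s hs
  have hZpos : 0 < volume.real Z := ENNReal.toReal_pos hZ0 hZfin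
  have hxy0 : 0 < |x - y| := abs_pos.mpr (sub_ne_zero.mpr hxy)
  rw [hrx, hlen] at h
  have h1 : (A * lam) ^ d * c ≤ (A * |x - y| / volume.real Z) ^ d * c :=
    hx.trans (h.trans (by gcongr))
  have h2 := (pow_le_pow_iff_left₀ (by positivity) (by positivity) hd).mp
    (le_of_mul_le_mul_right h1 hc)
  rw [le_div_iff₀ hZpos, mul_assoc] at h2
  have h3 := le_of_mul_le_mul_left h2 hA0
  rw [← ENNReal.ofReal_toReal hZfin]
  refine ENNReal.ofReal_le_ofReal ?_
  rw [inv_mul_eq_div, le_div_iff₀ hlam, mul_comm]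
  exact h3

/-! ### The comparison inequality -/

theorem continuous_norm_eval_ofReal {𝕜 : Type*} [RCLike 𝕜] {n : ℕ} (P : MvPolynomial (Fin n) 𝕜) :
    Continuous fun x : Fin n → ℝ => ‖P.eval fun i => ((x i : ℝ) : 𝕜)‖ :=
  (P.continuous_eval.comp (continuous_pi fun i =>
    RCLike.continuous_ofReal.comp (continuous_apply i))).norm

theorem exists_polynomial_on_line {𝕜 : Type*} [RCLike 𝕜] {n d : ℕ} {P : MvPolynomial (Fin n) 𝕜}
    (hP : P.totalDegree ≤ d) (v w : Fin n → ℝ) :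
    ∃ p : Polynomial 𝕜, p.natDegree ≤ d ∧ ∀ s : ℝ,
      p.eval (s : 𝕜) = P.eval fun i => (((v + s • w) i : ℝ) : 𝕜) := by
  refine ⟨MvPolynomial.aeval (fun i => Polynomial.C ((v i : ℝ) : 𝕜) +
    Polynomial.C ((w i : ℝ) : 𝕜) * Polynomial.X) P, ?_, fun s => ?_⟩
  · have h := MvPolynomial.aeval_natDegree_le (n := 1) P hP (fun i => Polynomial.C ((v i : ℝ) : 𝕜) +
      Polynomial.C ((w i : ℝ) : 𝕜) * Polynomial.X) fun i => by compute_degree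
    rwa [mul_one] at h
  · rw [← Polynomial.coe_evalRingHom, MvPolynomial.aeval_def, MvPolynomial.hom_eval₂,
      MvPolynomial.eval, MvPolynomial.coe_eval₂Hom]
    congr 1
    · ext a; simp
    · ext i; simp; ring

/-- On a thin convex body, where `|P|` deviates by less than `ε` from its values on a line, the
one-dimensional inequality for the marginal applies with thresholds `C - ε` and `c + ε`. -/
theorem measureReal_superlevel_le_of_thin {𝕜 : Type*} [RCLike 𝕜] {A : ℝ} (hA : IsRemezConstant A)
    {n d : ℕ} (hd : d ≠ 0) {P : MvPolynomial (Fin (n + 1)) 𝕜} (hP : P.totalDegree ≤ d)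
    {L : Set (Fin (n + 1) → ℝ)} (hL : IsCompact L) (hLconv : Convex ℝ L) {c C ε lam : ℝ}
    (hcε : 0 < c + ε) (hlam : 1 < lam) (hCε : (A * lam) ^ d * (c + ε) ≤ C - ε)
    {i : Fin (n + 1)} {v w : Fin (n + 1) → ℝ}
    (hthin : ∀ x ∈ L, |‖P.eval fun j => ((x j : ℝ) : 𝕜)‖ -
      ‖P.eval fun j => (((v + x i • w) j : ℝ) : 𝕜)‖| < ε) :
    volume.real L ^ (1 - lam⁻¹) *
      volume.real ({x | C ≤ ‖P.eval fun j => ((x j : ℝ) : 𝕜)‖} ∩ L) ^ lam⁻¹ ≤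
    volume.real ({x | c < ‖P.eval fun j => ((x j : ℝ) : 𝕜)‖} ∩ L) := by
  obtain ⟨p, hp, hpe⟩ := exists_polynomial_on_line hP v w
  simp_rw [← hpe] at hthin
  have hlam0 : 0 < lam := by linarith
  have hcont : Continuous fun s : ℝ => ‖p.eval (s : 𝕜)‖ :=
    (p.continuous.comp RCLike.continuous_ofReal).norm
  set G₁ := {s : ℝ | C - ε ≤ ‖p.eval (s : 𝕜)‖} with hG₁
  set H₁ := {s : ℝ | ‖p.eval (s : 𝕜)‖ ≤ c + ε} with hH₁
  have hG₁c : IsClosed G₁ := isClosed_le continuous_const hcont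
  have hH₁c : IsClosed H₁ := isClosed_le hcont continuous_const
  have hAlam : 1 < A * lam := by nlinarith [one_le_of_isRemezConstant hA]
  have hdisj : Disjoint G₁ H₁ := Set.disjoint_left.mpr fun s h1 h2 => by
    have h3 : 1 < (A * lam) ^ d := one_lt_pow₀ hAlam hd
    have h4 : C - ε ≤ c + ε := le_trans h1 h2
    nlinarith
  have hfin : ∀ S : Set (Fin (n + 1) → ℝ), volume (S ∩ L) ≠ ⊤ := fun S =>
    measure_ne_top_of_subset Set.inter_subset_right hL.measure_lt_top.ne
  have key := (isLogConcaveDensity_marginal i hL hLconv).measureReal_le_of_sparse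
    (inv_pos.mpr hlam0) (inv_lt_one_of_one_lt₀ hlam) hG₁c hH₁c hdisj fun x hx y =>
      volume_sublevel_inter_uIcc_le hA hd hp hcε hlam0 (hCε.trans hx) y
  rw [withDensity_marginal_real i hL.measurableSet MeasurableSet.univ,
    withDensity_marginal_real i hL.measurableSet hG₁c.measurableSet,
    withDensity_marginal_real i hL.measurableSet hH₁c.measurableSet.compl] at key
  have huniv : L ∩ {x | x i ∈ Set.univ} = L := by simp
  rw [huniv] at key
  have hE : volume.real (L ∩ {x | x i ∈ H₁ᶜ}) ≤
      volume.real ({x | c < ‖P.eval fun j => ((x j : ℝ) : 𝕜)‖} ∩ L) := by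
    refine measureReal_mono (fun x hx => ⟨?_, hx.1⟩) (hfin _)
    have h1 := (abs_lt.mp (hthin x hx.1)).1
    have h2 : c + ε < ‖p.eval ((x i : ℝ) : 𝕜)‖ := not_le.mp hx.2
    change c < _
    linarith
  have hG : volume.real ({x | C ≤ ‖P.eval fun j => ((x j : ℝ) : 𝕜)‖} ∩ L) ≤
      volume.real (L ∩ {x | x i ∈ G₁}) := by
    refine measureReal_mono (fun x hx => ⟨hx.2, ?_⟩)
      (measure_ne_top_of_subset Set.inter_subset_left hL.measure_lt_top.ne)
    have h1 := (abs_lt.mp (hthin x hx.2)).2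
    have h2 : C ≤ ‖P.eval fun j => ((x j : ℝ) : 𝕜)‖ := hx.1
    change C - ε ≤ ‖p.eval ((x i : ℝ) : 𝕜)‖
    linarith
  refine le_trans ?_ (key.trans hE)
  gcongr

/-- The comparison inequality in coordinates, for a positive degree bound. If it failed,
it would fail with some room to spare, and bisection would produce a thin convex body on which it
still fails. There the polynomial is almost constant across a line, and the one-dimensional
inequality for the marginal is contradicted. -/
theorem measureReal_superlevel_le {𝕜 : Type*} [RCLike 𝕜] {A : ℝ} (hA : IsRemezConstant A)
    {n d : ℕ} (hd : d ≠ 0) {P : MvPolynomial (Fin (n + 1)) 𝕜} (hP : P.totalDegree ≤ d)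
    {F : Set (Fin (n + 1) → ℝ)} (hF : IsCompact F) (hFconv : Convex ℝ F) (hF1 : volume.real F = 1)
    {c lam : ℝ} (hc : 0 < c) (hlam : 1 < lam) :
    volume.real ({x | (A * lam) ^ d * c ≤ ‖P.eval fun j => ((x j : ℝ) : 𝕜)‖} ∩ F) ≤
      volume.real ({x | c < ‖P.eval fun j => ((x j : ℝ) : 𝕜)‖} ∩ F) ^ lam := by
  by_contra! hlt
  have hA0 := hA.1
  set f : (Fin (n + 1) → ℝ) → ℝ := fun x => ‖P.eval fun j => ((x j : ℝ) : 𝕜)‖ with hf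
  set e := volume.real ({x | c < f x} ∩ F) with he
  set C := (A * lam) ^ d * c with hC
  have he0 : 0 ≤ e := measureReal_nonneg
  obtain ⟨lam', hlam', hlam'lt, hγ⟩ : ∃ lam', 1 < lam' ∧ lam' < lam ∧
      e ^ lam' < volume.real ({x | C ≤ f x} ∩ F) := by
    have hcont : ContinuousAt (fun s : ℝ => e ^ s) lam :=
      Real.continuousAt_const_rpow' (by linarith)
    have h1 := (hcont.tendsto.mono_left (nhdsWithin_le_nhds (s := Set.Iio lam))).eventually
      (gt_mem_nhds hlt)
    obtain ⟨s, hs1, hs2⟩ := (h1.and (Ioo_mem_nhdsLT hlam)).exists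
    exact ⟨s, hs2.1, hs2.2, hs1⟩
  have hbody : IsBisectionBody F {x | c < f x} {x | C ≤ f x} e (e ^ lam') F :=
    ⟨hF, hFconv, subset_rfl, by rw [hF1, mul_one], by rwa [hF1, mul_one]⟩
  have hpow : (A * lam') ^ d * c < C := by
    refine mul_lt_mul_of_pos_right (pow_lt_pow_left₀ ?_ (by positivity) hd) hc
    exact mul_lt_mul_of_pos_left hlam'lt hA0
  -- The slack `ε` solves `(A * lam') ^ d * (c + ε) = C - ε`.
  set B := (A * lam') ^ d with hB
  have hB0 : 0 < B := by positivity
  set ε := (C - B * c) / (1 + B) with hε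
  have hε0 : 0 < ε := div_pos (by linarith) (by linarith)
  have hεeq : B * (c + ε) = C - ε := by
    have : ε * (1 + B) = C - B * c := div_mul_cancel₀ _ (by positivity)
    linarith
  obtain ⟨L, i, v, w, hL, hthin⟩ :=
    hbody.exists_thin n.succ_pos (continuous_norm_eval_ofReal P) hε0
  have key := measureReal_superlevel_le_of_thin hA hd hP hL.isCompact hL.convex (by linarith) hlam'
    hεeq.le hthin
  have hEL := hL.measureReal_eq
  have hGL := hL.lt_measureReal
  set m := volume.real L with hm
  have hm0 : 0 < m := by
    refine lt_of_le_of_ne measureReal_nonneg fun h0 => ?_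
    rw [← h0, mul_zero] at hGL
    have : volume.real ({x | C ≤ f x} ∩ L) ≤ m :=
      measureReal_mono Set.inter_subset_right hL.isCompact.measure_lt_top.ne
    linarith
  have hlam'0 : 0 < lam' := by linarith
  change m ^ (1 - lam'⁻¹) * volume.real ({x | C ≤ f x} ∩ L) ^ lam'⁻¹ ≤
    volume.real ({x | c < f x} ∩ L) at key
  have h1 : (e ^ lam' * m) ^ lam'⁻¹ < volume.real ({x | C ≤ f x} ∩ L) ^ lam'⁻¹ :=
    Real.rpow_lt_rpow (by positivity) hGL (by positivity)
  rw [Real.mul_rpow (by positivity) hm0.le, Real.rpow_rpow_inv he0 hlam'0.ne'] at h1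
  have h2 : m ^ (1 - lam'⁻¹) * m ^ lam'⁻¹ = m := by
    rw [← Real.rpow_add hm0]; simp
  have h3 : m ^ (1 - lam'⁻¹) * (e * m ^ lam'⁻¹) <
      m ^ (1 - lam'⁻¹) * volume.real ({x | C ≤ f x} ∩ L) ^ lam'⁻¹ :=
    mul_lt_mul_of_pos_left h1 (Real.rpow_pos_of_pos hm0 _)
  have h4 : m ^ (1 - lam'⁻¹) * (e * m ^ lam'⁻¹) = e * m := by
    linear_combination e * h2
  linarith

theorem volume_superlevel_le_of_eq_C {𝕜 : Type*} [RCLike 𝕜] {A : ℝ} (hA : IsRemezConstant A)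
    {n d : ℕ} {a : 𝕜} {F : Set (EuclideanSpace ℝ (Fin n))} (hF1 : volume F = 1)
    {c lam : ℝ} (hc : 0 < c) (hlam : 1 ≤ lam) :
    volume {x ∈ F | (A * lam) ^ d * c ≤
        ‖(MvPolynomial.C a : MvPolynomial (Fin n) 𝕜).eval fun i => ((x i : ℝ) : 𝕜)‖} ≤
      (volume {x ∈ F | c ≤
        ‖(MvPolynomial.C a : MvPolynomial (Fin n) 𝕜).eval fun i => ((x i : ℝ) : 𝕜)‖}) ^ lam := by
  simp only [MvPolynomial.eval_C]
  have h1 : 1 ≤ (A * lam) ^ d := one_le_pow₀ (by nlinarith [one_le_of_isRemezConstant hA])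
  by_cases h : c ≤ ‖a‖
  · simp only [h, and_true, Set.ofPred_mem_eq, hF1, ENNReal.one_rpow]
    exact (measure_mono fun x hx => hx.1).trans hF1.le
  · have h2 : ¬ (A * lam) ^ d * c ≤ ‖a‖ := fun h' => h (by nlinarith)
    simp [h2]

theorem mainTheorem3 (𝕜 : Type*) [RCLike 𝕜] :
    IsRemezConstant 4 ∧
      ∀ A : ℝ, IsRemezConstant A →
        ∀ (n d : ℕ) (P : MvPolynomial (Fin n) 𝕜), P.totalDegree ≤ d →
          ∀ F : Set (EuclideanSpace ℝ (Fin n)), Convex ℝ F → IsCompact F → volume F = 1 →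
            ∀ c lam : ℝ, 0 < c → 1 ≤ lam →
              volume {x ∈ F | (A * lam) ^ d * c ≤ ‖P.eval (fun i => ((x i : ℝ) : 𝕜))‖} ≤
                (volume {x ∈ F | c ≤ ‖P.eval (fun i => ((x i : ℝ) : 𝕜))‖}) ^ lam := by
  refine ⟨isRemezConstant_four, fun A hA n d P hP F hFconv hF hF1 c lam hc hlam => ?_⟩
  rcases eq_or_ne d 0 with rfl | hd
  · rw [MvPolynomial.totalDegree_eq_zero_iff_eq_C.mp (Nat.le_zero.mp hP)]
    exact volume_superlevel_le_of_eq_C hA hF1 hc hlam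
  rcases n with _ | n
  · rw [MvPolynomial.eq_C_of_isEmpty P]
    exact volume_superlevel_le_of_eq_C hA hF1 hc hlam
  rcases eq_or_lt_of_le hlam with rfl | hlam
  · rw [ENNReal.rpow_one]
    refine measure_mono fun x hx => ⟨hx.1, le_trans ?_ hx.2⟩
    have : 1 ≤ (A * 1) ^ d := one_le_pow₀ (by linarith [one_le_of_isRemezConstant hA])
    nlinarith
  -- Transfer to `Fin (n + 1) → ℝ`, which carries the same Lebesgue measure.
  have hmp := PiLp.volume_preserving_toLp (Fin (n + 1))
  have hpre : ∀ S : Set (EuclideanSpace ℝ (Fin (n + 1))), MeasurableSet S →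
      volume (WithLp.toLp 2 ⁻¹' S : Set (Fin (n + 1) → ℝ)) = volume S :=
    fun S hS => hmp.measure_preimage hS.nullMeasurableSet
  have hcont : Continuous fun x : EuclideanSpace ℝ (Fin (n + 1)) =>
      ‖P.eval fun i => ((x i : ℝ) : 𝕜)‖ :=
    (continuous_norm_eval_ofReal P).comp (PiLp.continuous_ofLp 2 _)
  have hlevel : ∀ r : ℝ, MeasurableSet {x ∈ F | r ≤ ‖P.eval fun i => ((x i : ℝ) : 𝕜)‖} :=
    fun r => hF.measurableSet.inter (isClosed_le continuous_const hcont).measurableSet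
  set F' : Set (Fin (n + 1) → ℝ) := WithLp.toLp 2 ⁻¹' F with hF'
  have hF'c : IsCompact F' :=
    (PiLp.homeomorph 2 fun _ : Fin (n + 1) => ℝ).symm.isCompact_preimage.mpr hF
  have hF'conv : Convex ℝ F' :=
    hFconv.linear_preimage (WithLp.linearEquiv 2 ℝ (Fin (n + 1) → ℝ)).symm.toLinearMap
  have hF'1 : volume.real F' = 1 := by
    rw [measureReal_def, hF', hpre F hF.measurableSet, hF1, ENNReal.toReal_one]
  have key := measureReal_superlevel_le hA hd hP hF'c hF'conv hF'1 hc hlam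
  have hfin : ∀ S : Set (Fin (n + 1) → ℝ), volume (S ∩ F') ≠ ⊤ := fun S =>
    measure_ne_top_of_subset Set.inter_subset_right hF'c.measure_lt_top.ne
  rw [measureReal_def, measureReal_def, ENNReal.toReal_rpow, ENNReal.toReal_le_toReal (hfin _)
    (ENNReal.rpow_ne_top_of_nonneg (by linarith) (hfin _))] at key
  rw [← hpre _ (hlevel _), ← hpre _ (hlevel _)]
  refine le_trans (measure_mono ?_) (key.trans ?_)
  · exact fun x hx => ⟨hx.2, hx.1⟩
  · gcongr
    exact fun x hx => ⟨hx.2, le_of_lt hx.1⟩
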